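/- Let $(\overline M,g,J)$ be a (finite-dimensional) Kähler manifold with Ricci tensor $\mathrm{Ric}$ and Ricci form $\rho(X,Y)=\mathrm{Ric}(JX,Y)$. For $\lambda\in\mathbb R$ and an interval $I\subseteq\mathbb R$, a smooth curve $\alpha:I\to\overline M$ is called Ricci magnetic geodesic with parameter $\lambda$ (RMG$_\lambda$) if $\nabla_{d/dt}\dot\alpha=\lambda\,\sharp(\iota_{\dot\alpha}\rho)$, where $\nabla$ is the Levi-Civita connection of $g$ (pulled back along $\alpha$), $\iota$ is interior multiplication and $\sharp:T^*\overline M\to T\overline M$ is the isomorphism induced by $g$. (1) Let $G$ be a group of holomorphic isometries of $\overline M$ onto itself, and let $M$ be a connected component of the fixed point set of $G$. Let $\lambda\in\mathbb R$, let $I$ be an interval containing $0$, and let $\alpha:I\to\overline M$ be an RMG$_\lambda$ curve on $\overline M$ with $\alpha(0)\in M$ and $\dot\alpha(0)\in T_{\alpha(0)}M$. Then $\alpha(t)\in M$ for all $t\in I$. (2) In general the flow so obtained on $M$ is different from the RMG flow of $M$ as a Kähler manifold in its own right, with the metric and complex structure induced from $\overline M$. That is, there are a Kähler metric on $\overline M=\mathbb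 C^2$ (with its standard complex structure), a group $G$ of holomorphic isometries of $\overline M$, a Kähler metric on $\mathbb C$, and a holomorphic isometric embedding $f:\mathbb C\to\overline M$ whose image is a connected component of the fixed point set of $G$, such that for every $\lambda\neq0$ there is a smooth curve $\alpha:\mathbb R\to\mathbb C$ for which $f\circ\alpha$ is RMG$_\lambda$ on $\overline M$, but $\alpha$ is not RMG$_\lambda$ on $\mathbb C$. -/

import Mathlib

open scoped Manifold ContDiff Topology

set_option maxSynthPendingDepth 3

noncomputable section

namespace Kaehler

/-! ### Local Riemannian geometry

`G : E → E →L[ℝ] E →L[ℝ] ℝ` is a metric on (an open subset of) a real vector space `E`, and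
all the formulas are the usual local coordinate expressions, written without indices. -/

section Local

variable {E : Type*} [NormedAddCommGroup E] [NormedSpace ℝ E]

/-- The Levi-Civita connection of `G`, lowered by `G`: the covector
`w ↦ (D_u G (v, w) + D_v G (u, w) - D_w G (u, v)) / 2` at the point `y`
(Christoffel symbols of the first kind). -/
def christoffelFst (G : E → E →L[ℝ] E →L[ℝ] ℝ) (y : E) : E →L[ℝ] E →L[ℝ] E →L[ℝ] ℝ :=
  let D : E →L[ℝ] E →L[ℝ] E →L[ℝ] ℝ := fderiv ℝ G y
  let F : (E →L[ℝ] E →L[ℝ] ℝ) →L[ℝ] (E →L[ℝ] E →L[ℝ] ℝ) :=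
    (ContinuousLinearMap.flipₗᵢ ℝ E E ℝ).toContinuousLinearEquiv.toContinuousLinearMap
  let D₁ : E →L[ℝ] E →L[ℝ] E →L[ℝ] ℝ := D.flip
  let D₂ : E →L[ℝ] E →L[ℝ] E →L[ℝ] ℝ := F ∘L D₁
  (1 / 2 : ℝ) • (D + D₁ - D₂)

theorem christoffelFst_apply (G : E → E →L[ℝ] E →L[ℝ] ℝ) (y u v w : E) :
    christoffelFst G y u v w =
      (1 / 2 : ℝ) * (fderiv ℝ G y u v w + fderiv ℝ G y v u w - fderiv ℝ G y w u v) := rfl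

/-- The Christoffel symbols (of the second kind) of `G` at `y`, as a bilinear map: the vector
`Γ(u, v)` with `G y (Γ(u, v)) w = christoffelFst G y u v w`. Here `(G y).inverse` is the
isomorphism from covectors to vectors inverse to `u ↦ G y u`. -/
def christoffel (G : E → E →L[ℝ] E →L[ℝ] ℝ) (y : E) : E →L[ℝ] E →L[ℝ] E :=
  (ContinuousLinearMap.compL ℝ E (E →L[ℝ] ℝ) E (G y).inverse) ∘L christoffelFst G y

theorem christoffel_apply (G : E → E →L[ℝ] E →L[ℝ] ℝ) (y u v : E) :
    christoffel G y u v = (G y).inverse (christoffelFst G y u v) := rfl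

/-- The curvature `R(u, v) w = ∇_u ∇_v w - ∇_v ∇_u w` (on constant fields) of `G` at `y`,
as a linear map in the argument `u`. -/
def curvature (G : E → E →L[ℝ] E →L[ℝ] ℝ) (y v w : E) : E →L[ℝ] E :=
  ((fderiv ℝ (christoffel G) y).flip v).flip w - (fderiv ℝ (christoffel G) y v).flip w +
    (christoffel G y).flip (christoffel G y v w) - (christoffel G y v) ∘L (christoffel G y).flip w

theorem curvature_apply (G : E → E →L[ℝ] E →L[ℝ] ℝ) (y u v w : E) :
    curvature G y v w u =
      fderiv ℝ (christoffel G) y u v w - fderiv ℝ (christoffel G) y v u w +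
      christoffel G y u (christoffel G y v w) - christoffel G y v (christoffel G y u w) := rfl

/-- The Ricci tensor of `G` at `y`: the trace of `u ↦ R(u, v) w`. -/
def ricci (G : E → E →L[ℝ] E →L[ℝ] ℝ) (y v w : E) : ℝ :=
  LinearMap.trace ℝ E (curvature G y v w)

end Local

/-! ### Kähler manifolds -/

section Manifold

variable {E : Type*} [NormedAddCommGroup E] [NormedSpace ℂ E]
  {M : Type*} [TopologicalSpace M] [ChartedSpace E M]

/-- A complex manifold is a real manifold, with the same charts. -/
instance (priority := 50) isManifold_real [IsManifold 𝓘(ℂ, E) ω M] (n : ℕ∞ω) :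
    IsManifold 𝓘(ℝ, E) n M := by
  refine isManifold_of_contDiffOn 𝓘(ℝ, E) n M fun e e' he he' => ?_
  have h := (contDiffGroupoid ω 𝓘(ℂ, E)).compatible he he'
  have h2 := (contDiffGroupoid_le (I := 𝓘(ℂ, E)) (m := n) (n := ω) le_top) h
  exact ContDiffOn.restrict_scalars (𝕜 := ℝ) (𝕜' := ℂ) (mem_groupoid_of_pregroupoid.1 h2).1

/-- The complex structure of a complex vector space, as a real linear map. -/
def mulI (E : Type*) [NormedAddCommGroup E] [NormedSpace ℂ E] : E →L[ℝ] E :=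
  Complex.I • ContinuousLinearMap.id ℝ E

/-- The almost complex structure of a complex manifold: multiplication by `i` in any
holomorphic chart, in particular in the preferred one, through which Mathlib identifies the
tangent space with `E`. -/
def J (x : M) : TangentSpace 𝓘(ℝ, E) x →L[ℝ] TangentSpace 𝓘(ℝ, E) x :=
  mulI E

/-- The coordinate expression, in the preferred chart at `x`, of a bilinear form `b` on the
tangent bundle: the pullback of `b` by the inverse of the chart. -/
def inChart
    (b : ∀ x : M, TangentSpace 𝓘(ℝ, E) x →L[ℝ] TangentSpace 𝓘(ℝ, E) x →L[ℝ] ℝ)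
    (x : M) (y : E) : E →L[ℝ] E →L[ℝ] ℝ :=
  let B : E →L[ℝ] E →L[ℝ] ℝ := b ((extChartAt 𝓘(ℝ, E) x).symm y)
  let D : E →L[ℝ] E := mfderiv 𝓘(ℝ, E) 𝓘(ℝ, E) (extChartAt 𝓘(ℝ, E) x).symm y
  B.bilinearComp D D

/-- A Kähler metric on the complex manifold `M`: a smooth Riemannian metric which is Hermitian
and whose fundamental form `ω(u, v) = g(J u, v)` is closed. -/
structure KaehlerMetric (E : Type*) [NormedAddCommGroup E] [NormedSpace ℂ E]
    (M : Type*) [TopologicalSpace M] [ChartedSpace E M] [IsManifold 𝓘(ℂ, E) ω M] extends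
    Bundle.ContMDiffRiemannianMetric 𝓘(ℝ, E) ∞ E
      (fun x : M => TangentSpace 𝓘(ℝ, E) x) where
  hermitian : ∀ (x : M) (u v : TangentSpace 𝓘(ℝ, E) x), inner x (J x u) (J x v) = inner x u v
  closed : ∀ (x : M) (u v w : E),
    fderiv ℝ (fun y => inChart inner x y (mulI E v) w) (extChartAt 𝓘(ℝ, E) x x) u +
    fderiv ℝ (fun y => inChart inner x y (mulI E w) u) (extChartAt 𝓘(ℝ, E) x x) v +
    fderiv ℝ (fun y => inChart inner x y (mulI E u) v) (extChartAt 𝓘(ℝ, E) x x) w = 0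

variable [IsManifold 𝓘(ℂ, E) ω M]

/-- The Ricci form `ρ(u, v) = Ric(J u, v)`, computed in the preferred chart at `x`. -/
def ricciForm (g : KaehlerMetric E M) (x : M) (u v : TangentSpace 𝓘(ℝ, E) x) : ℝ :=
  ricci (inChart g.inner x) (extChartAt 𝓘(ℝ, E) x x) (J x u) v

/-- The velocity at time `t` of a curve `α` defined on `I ⊆ ℝ`. -/
def velocity (I : Set ℝ) (α : ℝ → M) (t : ℝ) : TangentSpace 𝓘(ℝ, E) (α t) :=
  mfderivWithin 𝓘(ℝ, ℝ) 𝓘(ℝ, E) α I t (1 : ℝ)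

/-- The covariant derivative `∇_{d/dt} α'` of the velocity along the curve `α` on `I`, for the
Levi-Civita connection: `c'' + Γ(c', c')` at time `t`, where `c` is the expression of `α` in the
preferred chart at `α t`. -/
def acceleration (g : KaehlerMetric E M) (I : Set ℝ) (α : ℝ → M) (t : ℝ) :
    TangentSpace 𝓘(ℝ, E) (α t) :=
  let c : ℝ → E := fun s => extChartAt 𝓘(ℝ, E) (α t) (α s)
  derivWithin (derivWithin c I) I t +
    christoffel (inChart g.inner (α t)) (c t) (derivWithin c I t) (derivWithin c I t)

/-- `α : I → M` is a Ricci magnetic geodesic with parameter `lam`: it is smooth and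
`∇_{d/dt} α' = lam • ♯ (ι_{α'} ρ)`; by definition of the metric isomorphism `♯`, this means that
`g(∇_{d/dt} α', w) = lam * ρ(α', w)` for every tangent vector `w`. -/
structure IsRMG (g : KaehlerMetric E M) (lam : ℝ) (I : Set ℝ) (α : ℝ → M) : Prop where
  smooth : ContMDiffOn 𝓘(ℝ, ℝ) 𝓘(ℝ, E) ∞ α I
  eq : ∀ t ∈ I, ∀ w : TangentSpace 𝓘(ℝ, E) (α t),
    g.inner (α t) (acceleration g I α t) w = lam * ricciForm g (α t) (velocity I α t) w

/-- `φ` is smooth, holomorphic (its differential commutes with the complex structures) and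
its differential preserves the metrics. -/
structure IsHolomorphicIsometric
    {F : Type*} [NormedAddCommGroup F] [NormedSpace ℂ F]
    {N : Type*} [TopologicalSpace N] [ChartedSpace F N] [IsManifold 𝓘(ℂ, F) ω N]
    (g : KaehlerMetric E M) (h : KaehlerMetric F N) (φ : M → N) : Prop where
  smooth : ContMDiff 𝓘(ℝ, E) 𝓘(ℝ, F) ∞ φ
  holomorphic : ∀ (x : M) (u : TangentSpace 𝓘(ℝ, E) x),
    mfderiv 𝓘(ℝ, E) 𝓘(ℝ, F) φ x (J x u) = J (φ x) (mfderiv 𝓘(ℝ, E) 𝓘(ℝ, F) φ x u)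
  isometric : ∀ (x : M) (u v : TangentSpace 𝓘(ℝ, E) x),
    h.inner (φ x) (mfderiv 𝓘(ℝ, E) 𝓘(ℝ, F) φ x u) (mfderiv 𝓘(ℝ, E) 𝓘(ℝ, F) φ x v) =
      g.inner x u v

/-- `G`, a group of bijections of `M` onto itself, is a group of holomorphic isometries. (The
inverse of an element of `G` is again in `G`, so the elements of `G` are biholomorphic.) -/
def IsGroupOfHolomorphicIsometries (g : KaehlerMetric E M) (G : Subgroup (Equiv.Perm M)) : Prop :=
  ∀ φ ∈ G, IsHolomorphicIsometric g g φ

/-- `S` is a connected component of the fixed point set of `G`. -/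
def IsFixedComponent {X : Type*} [TopologicalSpace X] (G : Subgroup (Equiv.Perm X))
    (S : Set X) : Prop :=
  ∃ p ∈ MulAction.fixedPoints G X, S = connectedComponentIn (MulAction.fixedPoints G X) p

/-- The tangent vector `v` (a point of the tangent bundle) is tangent to the subset `S` of `M`:
it is the velocity at time `0` of a smooth curve of `M` lying in `S`. For a submanifold `S` these
vectors form its tangent bundle. -/
def IsTangentTo (S : Set M) (v : TangentBundle 𝓘(ℝ, E) M) : Prop :=
  ∃ (ε : ℝ) (γ : ℝ → M), 0 < ε ∧ ContMDiffOn 𝓘(ℝ, ℝ) 𝓘(ℝ, E) ∞ γ (Set.Ioo (-ε) ε) ∧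
    (∀ t ∈ Set.Ioo (-ε) ε, γ t ∈ S) ∧
    (⟨γ 0, velocity (Set.Ioo (-ε) ε) γ 0⟩ : TangentBundle 𝓘(ℝ, E) M) = v

end Manifold

end Kaehler

end

noncomputable section

namespace Kaehler

/-! ### Local Riemannian geometry: naturality -/

section Local

variable {E : Type*} [NormedAddCommGroup E] [NormedSpace ℝ E]

/-! Part (1). A holomorphic isometry preserves the Levi-Civita connection, the Ricci tensor and the
complex structure, so it carries RMG curves to RMG curves. The RMG equation is a second-order ODE,
so point and velocity at one time determine the curve nearby. Let φ ∈ G. Tangency makes the initial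
velocity of α the velocity of a curve γ lying in the fixed set; since φ fixes γ pointwise, dφ fixes
that velocity. Hence φ ∘ α = α near 0, and an open-closed argument extends this to all of I
(`IsRMG.fixed`). Then α(I) is a connected set of fixed points meeting S, so it lies in S. No
submanifold structure on S is needed.

The work is done in preferred charts: `IsIsometryOn` describes local isometries of open sets of a
vector space, `IsIsometryOn.map_christoffel` and `IsIsometryOn.ricci_eq` give naturality,
`IsRMGAt.comp` transports the equation, and `IsRMGAt.eventuallyEq` gives uniqueness.

Part (2). Let h = exp|z|²|dz|² on ℂ, and let the swap act on (ℂ², h × h). Its fixed set is the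
diagonal, whose induced metric is 2h. Connection and Ricci tensor do not change under scaling, but ♯
is halved. Along the diagonal the ambient equation is the RMG equation of h twice over, while the
intrinsic force is half as large. A uniform motion on the unit circle with nonzero magnetic force
separates the two. -/

/-- `G` is a smooth Riemannian metric on the open subset `U` of a vector space. -/
structure IsMetricOn (G : E → E →L[ℝ] E →L[ℝ] ℝ) (U : Set E) : Prop where
  isOpen : IsOpen U
  smooth : ContDiffOn ℝ ∞ G U
  symm : ∀ y ∈ U, ∀ u v, G y u v = G y v u
  pos : ∀ y ∈ U, ∀ u, u ≠ 0 → 0 < G y u u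

/-- `ψ` is a smooth map from `U` to `V` whose differential pulls the metric `H` back to `G`. -/
structure IsIsometryOn (G : E → E →L[ℝ] E →L[ℝ] ℝ) (U : Set E) (H : E → E →L[ℝ] E →L[ℝ] ℝ)
    (V : Set E) (ψ : E → E) : Prop where
  smooth : ContDiffOn ℝ ∞ ψ U
  mapsTo : Set.MapsTo ψ U V
  isometric : ∀ y ∈ U, ∀ u v, G y u v = H (ψ y) (fderiv ℝ ψ y u) (fderiv ℝ ψ y v)

/-- Positivity gives injectivity, and a finite-dimensional space has the dimension of its dual. -/
theorem isInvertible_of_pos [FiniteDimensional ℝ E] {B : E →L[ℝ] E →L[ℝ] ℝ}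
    (hB : ∀ u, u ≠ 0 → 0 < B u u) : B.IsInvertible := by
  let φ : E →ₗ[ℝ] (E →L[ℝ] ℝ) := B
  have hinj : Function.Injective φ := by
    rw [← LinearMap.ker_eq_bot, LinearMap.ker_eq_bot']
    intro u hu
    by_contra h
    have h1 := hB u h
    have h2 : B u = 0 := hu
    simp [h2] at h1
  have hdim : Module.finrank ℝ E = Module.finrank ℝ (E →L[ℝ] ℝ) := by
    rw [← (LinearMap.toContinuousLinearMap (𝕜 := ℝ) (E := E) (F' := ℝ)).finrank_eq]
    exact (Subspace.dual_finrank_eq (K := ℝ) (V := E)).symm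
  let e : E ≃ₗ[ℝ] (E →L[ℝ] ℝ) := LinearEquiv.ofInjectiveOfFinrankEq φ hinj hdim
  refine ⟨e.toContinuousLinearEquiv, ?_⟩
  ext u v
  rfl

theorem two_le_smooth : minSmoothness ℝ 2 ≤ ∞ := by
  rw [minSmoothness_of_isRCLikeNormedField]
  exact WithTop.coe_le_coe.2 (le_top : (2 : ℕ∞) ≤ ⊤)

variable {G H : E → E →L[ℝ] E →L[ℝ] ℝ} {U V : Set E} {ψ : E → E}

/-! ### Nondegeneracy of a metric and smoothness of its Christoffel symbols. -/

namespace IsMetricOn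

theorem mono (hG : IsMetricOn G U) (hV : IsOpen V) (h : V ⊆ U) : IsMetricOn G V :=
  ⟨hV, hG.smooth.mono h, fun y hy => hG.symm y (h hy), fun y hy => hG.pos y (h hy)⟩

theorem differentiableAt (hG : IsMetricOn G U) {y : E} (hy : y ∈ U) : DifferentiableAt ℝ G y :=
  (hG.smooth.contDiffAt (hG.isOpen.mem_nhds hy)).differentiableAt (by simp)

theorem contDiffOn_christoffelFst (hG : IsMetricOn G U) :
    ContDiffOn ℝ ∞ (christoffelFst G) U := by
  have hD : ContDiffOn ℝ ∞ (fderiv ℝ G) U := hG.smooth.fderiv_of_isOpen hG.isOpen (by simp)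
  have hflip : ContDiffOn ℝ ∞ (fun y => (fderiv ℝ G y).flip) U :=
    (ContinuousLinearMap.flipₗᵢ ℝ E E (E →L[ℝ] ℝ)).toContinuousLinearEquiv.contDiff.comp_contDiffOn
      hD
  exact ((hD.add hflip).sub (contDiffOn_const.clm_comp hflip)).const_smul (1 / 2 : ℝ)

theorem ext_left (hG : IsMetricOn G U) {y : E} (hy : y ∈ U) {u v : E}
    (h : ∀ w, G y u w = G y v w) : u = v := by
  by_contra hne
  have h1 := hG.pos y hy (u - v) (sub_ne_zero.2 hne)
  have h2 : G y (u - v) = 0 := by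
    ext w
    simp [h w]
  simp [h2] at h1

variable [FiniteDimensional ℝ E]

theorem isInvertible (hG : IsMetricOn G U) {y : E} (hy : y ∈ U) : (G y).IsInvertible :=
  isInvertible_of_pos (hG.pos y hy)

theorem apply_inverse (hG : IsMetricOn G U) {y : E} (hy : y ∈ U) (l : E →L[ℝ] ℝ) :
    G y ((G y).inverse l) = l := by
  obtain ⟨e, he⟩ := hG.isInvertible hy
  rw [← he]
  simp

theorem apply_christoffel (hG : IsMetricOn G U) {y : E} (hy : y ∈ U) (u v w : E) :
    G y (christoffel G y u v) w = christoffelFst G y u v w := by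
  rw [christoffel_apply, hG.apply_inverse hy]

/-- Christoffel symbols can thus be computed by guessing them and checking the defining identity,
without inverting the metric. -/
theorem christoffel_eq (hG : IsMetricOn G U) {y : E} (hy : y ∈ U) {u v z : E}
    (h : ∀ w, G y z w = christoffelFst G y u v w) : christoffel G y u v = z :=
  hG.ext_left hy fun w => by rw [hG.apply_christoffel hy, h]

theorem contDiffOn_inverse (hG : IsMetricOn G U) :
    ContDiffOn ℝ ∞ (fun y => (G y).inverse) U := by
  have : CompleteSpace E := FiniteDimensional.complete ℝ E
  intro y hy
  obtain ⟨e, he⟩ := hG.isInvertible hy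
  have h1 : ContDiffAt ℝ ∞ ContinuousLinearMap.inverse (G y) := he ▸ contDiffAt_map_inverse e
  exact h1.comp_contDiffWithinAt y (hG.smooth y hy)

theorem contDiffOn_christoffel (hG : IsMetricOn G U) : ContDiffOn ℝ ∞ (christoffel G) U := by
  have h := (ContinuousLinearMap.compL ℝ E (E →L[ℝ] ℝ) E).contDiff.comp_contDiffOn
    hG.contDiffOn_inverse
  exact h.clm_comp hG.contDiffOn_christoffelFst

theorem differentiableAt_christoffel (hG : IsMetricOn G U) {y : E} (hy : y ∈ U) :
    DifferentiableAt ℝ (christoffel G) y :=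
  (hG.contDiffOn_christoffel.contDiffAt (hG.isOpen.mem_nhds hy)).differentiableAt (by simp)

end IsMetricOn

/-! ### Transformation laws under local isometries, up to the Ricci tensor. -/

namespace IsIsometryOn

theorem contDiffAt (h : IsIsometryOn G U H V ψ) (hU : IsOpen U) {y : E} (hy : y ∈ U) :
    ContDiffAt ℝ ∞ ψ y :=
  h.smooth.contDiffAt (hU.mem_nhds hy)

theorem contDiffOn_fderiv (h : IsIsometryOn G U H V ψ) (hU : IsOpen U) :
    ContDiffOn ℝ ∞ (fderiv ℝ ψ) U :=
  h.smooth.fderiv_of_isOpen hU (by simp)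

theorem hasFDerivAt (h : IsIsometryOn G U H V ψ) (hU : IsOpen U) {y : E} (hy : y ∈ U) :
    HasFDerivAt ψ (fderiv ℝ ψ y) y :=
  ((h.contDiffAt hU hy).differentiableAt (by simp)).hasFDerivAt

theorem hasFDerivAt_fderiv (h : IsIsometryOn G U H V ψ) (hU : IsOpen U) {y : E} (hy : y ∈ U) :
    HasFDerivAt (fderiv ℝ ψ) (fderiv ℝ (fderiv ℝ ψ) y) y :=
  (((h.contDiffOn_fderiv hU).contDiffAt (hU.mem_nhds hy)).differentiableAt (by simp)).hasFDerivAt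

theorem hasFDerivAt_fderiv_fderiv (h : IsIsometryOn G U H V ψ) (hU : IsOpen U) {y : E}
    (hy : y ∈ U) :
    HasFDerivAt (fderiv ℝ (fderiv ℝ ψ)) (fderiv ℝ (fderiv ℝ (fderiv ℝ ψ)) y) y :=
  ((((h.contDiffOn_fderiv hU).fderiv_of_isOpen (m := ∞) hU (by simp)).contDiffAt
    (hU.mem_nhds hy)).differentiableAt (by simp)).hasFDerivAt

theorem fderiv_fderiv_symm (h : IsIsometryOn G U H V ψ) (hU : IsOpen U) {y : E} (hy : y ∈ U)
    (u v : E) : fderiv ℝ (fderiv ℝ ψ) y u v = fderiv ℝ (fderiv ℝ ψ) y v u :=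
  (h.contDiffAt hU hy).isSymmSndFDerivAt two_le_smooth u v

theorem fderiv_fderiv_fderiv_symm (h : IsIsometryOn G U H V ψ) (hU : IsOpen U) {y : E}
    (hy : y ∈ U) (u v w : E) :
    fderiv ℝ (fderiv ℝ (fderiv ℝ ψ)) y u v w = fderiv ℝ (fderiv ℝ (fderiv ℝ ψ)) y v u w := by
  have := ((h.contDiffOn_fderiv hU).contDiffAt (hU.mem_nhds hy)).isSymmSndFDerivAt two_le_smooth u v
  rw [this]

/-- Product rule applied to the isometry identity, which holds on a neighbourhood of `y`. -/
theorem fderiv_metric (hG : IsMetricOn G U) (hH : IsMetricOn H V) (h : IsIsometryOn G U H V ψ)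
    {y : E} (hy : y ∈ U) (a u v : E) :
    fderiv ℝ G y a u v =
      fderiv ℝ H (ψ y) (fderiv ℝ ψ y a) (fderiv ℝ ψ y u) (fderiv ℝ ψ y v) +
      H (ψ y) (fderiv ℝ (fderiv ℝ ψ) y a u) (fderiv ℝ ψ y v) +
      H (ψ y) (fderiv ℝ ψ y u) (fderiv ℝ (fderiv ℝ ψ) y a v) := by
  have hU := hG.isOpen
  have hleft := ((hG.differentiableAt hy).hasFDerivAt.clm_apply
    (hasFDerivAt_const u y)).clm_apply (hasFDerivAt_const v y)
  have hψ := h.hasFDerivAt hU hy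
  have hψ' := h.hasFDerivAt_fderiv hU hy
  have hHψ := (hH.differentiableAt (h.mapsTo hy)).hasFDerivAt.comp y hψ
  have hright := (hHψ.clm_apply (hψ'.clm_apply (hasFDerivAt_const u y))).clm_apply
    (hψ'.clm_apply (hasFDerivAt_const v y))
  have heq : (fun z => G z u v) =ᶠ[𝓝 y]
      fun z => (H ∘ ψ) z (fderiv ℝ ψ z u) (fderiv ℝ ψ z v) := by
    filter_upwards [hU.mem_nhds hy] with z hz using h.isometric z hz u v
  have := congrArg (fun L : E →L[ℝ] ℝ => L a) (hleft.unique (hright.congr_of_eventuallyEq heq))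
  simp at this
  rw [this]
  ring

variable [FiniteDimensional ℝ E]

/-- The differential of an isometry, as an automorphism of `E`. -/
theorem exists_equiv (hG : IsMetricOn G U) (h : IsIsometryOn G U H V ψ) {y : E} (hy : y ∈ U) :
    ∃ e : E ≃ₗ[ℝ] E, (e : E →ₗ[ℝ] E) = (fderiv ℝ ψ y : E →ₗ[ℝ] E) := by
  have hinj : Function.Injective (fderiv ℝ ψ y : E →ₗ[ℝ] E) := by
    rw [← LinearMap.ker_eq_bot, LinearMap.ker_eq_bot']
    intro u hu
    by_contra hne
    have h1 := hG.pos y hy u hne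
    have h2 : fderiv ℝ ψ y u = 0 := hu
    simp [h.isometric y hy, h2] at h1
  exact ⟨LinearEquiv.ofInjectiveEndo _ hinj, by ext; rfl⟩

/-- Allows identities between vectors at `ψ y` to be tested against images of vectors at `y` only.
-/
theorem surjective (hG : IsMetricOn G U) (h : IsIsometryOn G U H V ψ) {y : E} (hy : y ∈ U) :
    Function.Surjective (fderiv ℝ ψ y) := by
  obtain ⟨e, he⟩ := h.exists_equiv hG hy
  intro w
  obtain ⟨u, rfl⟩ := e.surjective w
  exact ⟨u, (LinearMap.congr_fun he u).symm⟩

/-- The transformation law of the Christoffel symbols. -/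
theorem map_christoffel (hG : IsMetricOn G U) (hH : IsMetricOn H V)
    (h : IsIsometryOn G U H V ψ) {y : E} (hy : y ∈ U) (u v : E) :
    fderiv ℝ ψ y (christoffel G y u v) =
      christoffel H (ψ y) (fderiv ℝ ψ y u) (fderiv ℝ ψ y v) + fderiv ℝ (fderiv ℝ ψ) y u v := by
  refine hH.ext_left (h.mapsTo hy) fun w' => ?_
  obtain ⟨w, rfl⟩ := h.surjective hG hy w'
  rw [← h.isometric y hy, hG.apply_christoffel hy, map_add, add_apply,
    hH.apply_christoffel (h.mapsTo hy), christoffelFst_apply, christoffelFst_apply]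
  simp only [h.fderiv_metric hG hH hy]
  -- Of the six terms with second derivatives of `ψ`, four cancel by these symmetries. The other two
  -- both equal the pairing of `ψ''(u, v)` with `ψ' w`, and the factor 1/2 leaves one copy.
  have s1 := h.fderiv_fderiv_symm hG.isOpen hy v u
  have s2 := h.fderiv_fderiv_symm hG.isOpen hy w u
  have s3 := h.fderiv_fderiv_symm hG.isOpen hy w v
  have s4 := hH.symm _ (h.mapsTo hy) (fderiv ℝ ψ y v) (fderiv ℝ (fderiv ℝ ψ) y u w)
  have s5 := hH.symm _ (h.mapsTo hy) (fderiv ℝ ψ y u) (fderiv ℝ (fderiv ℝ ψ) y v w)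
  rw [s1, s2, s3, s4, s5]
  ring

/-- Derivative in direction `a` of the transformation law `map_christoffel`, solved for the term
with the derivative of `christoffel G`. -/
theorem map_fderiv_christoffel (hG : IsMetricOn G U) (hH : IsMetricOn H V)
    (h : IsIsometryOn G U H V ψ) {y : E} (hy : y ∈ U) (a u v : E) :
    fderiv ℝ ψ y (fderiv ℝ (christoffel G) y a u v) =
      fderiv ℝ (christoffel H) (ψ y) (fderiv ℝ ψ y a) (fderiv ℝ ψ y u) (fderiv ℝ ψ y v) +
      christoffel H (ψ y) (fderiv ℝ (fderiv ℝ ψ) y a u) (fderiv ℝ ψ y v) +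
      christoffel H (ψ y) (fderiv ℝ ψ y u) (fderiv ℝ (fderiv ℝ ψ) y a v) +
      fderiv ℝ (fderiv ℝ (fderiv ℝ ψ)) y a u v -
      fderiv ℝ (fderiv ℝ ψ) y a (christoffel G y u v) := by
  have hU := hG.isOpen
  have hψ := h.hasFDerivAt hU hy
  have hψ' := h.hasFDerivAt_fderiv hU hy
  have hψ'' := h.hasFDerivAt_fderiv_fderiv hU hy
  have hΓ := (hG.differentiableAt_christoffel hy).hasFDerivAt
  have hΓH := (hH.differentiableAt_christoffel (h.mapsTo hy)).hasFDerivAt.comp y hψ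
  have hu := hasFDerivAt_const (𝕜 := ℝ) u y
  have hv := hasFDerivAt_const (𝕜 := ℝ) v y
  have hleft := hψ'.clm_apply ((hΓ.clm_apply hu).clm_apply hv)
  have hright := ((hΓH.clm_apply (hψ'.clm_apply hu)).clm_apply (hψ'.clm_apply hv)).add
    ((hψ''.clm_apply hu).clm_apply hv)
  have heq : (fun z => fderiv ℝ ψ z (christoffel G z u v)) =ᶠ[𝓝 y]
      fun z => (christoffel H ∘ ψ) z (fderiv ℝ ψ z u) (fderiv ℝ ψ z v) +
        fderiv ℝ (fderiv ℝ ψ) z u v := by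
    filter_upwards [hU.mem_nhds hy] with z hz using h.map_christoffel hG hH hz u v
  have := congrArg (fun L : E →L[ℝ] E => L a) (hleft.unique (hright.congr_of_eventuallyEq heq))
  simp at this
  rw [eq_sub_iff_add_eq, this]
  abel

/-- Isometries preserve the curvature. -/
theorem map_curvature (hG : IsMetricOn G U) (hH : IsMetricOn H V)
    (h : IsIsometryOn G U H V ψ) {y : E} (hy : y ∈ U) (u v w : E) :
    fderiv ℝ ψ y (curvature G y v w u) =
      curvature H (ψ y) (fderiv ℝ ψ y v) (fderiv ℝ ψ y w) (fderiv ℝ ψ y u) := by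
  -- Third derivatives of `ψ` and the `ψ''(u, v)` terms cancel by symmetry in `u, v`; the remaining
  -- `ψ''` terms cancel between the derivatives of Γ and the quadratic terms in Γ.
  simp only [curvature_apply, map_sub, map_add, h.map_fderiv_christoffel hG hH hy,
    h.map_christoffel hG hH hy, h.fderiv_fderiv_fderiv_symm hG.isOpen hy v u w,
    h.fderiv_fderiv_symm hG.isOpen hy v u]
  abel

/-- The differential conjugates one curvature endomorphism into the other, and the trace is
invariant under conjugation. -/
theorem ricci_eq (hG : IsMetricOn G U) (hH : IsMetricOn H V)
    (h : IsIsometryOn G U H V ψ) {y : E} (hy : y ∈ U) (v w : E) :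
    ricci G y v w = ricci H (ψ y) (fderiv ℝ ψ y v) (fderiv ℝ ψ y w) := by
  obtain ⟨e, he⟩ := h.exists_equiv hG hy
  have he' : ∀ u, e u = fderiv ℝ ψ y u := fun u => LinearMap.congr_fun he u
  rw [ricci, ricci, ← LinearMap.trace_conj' _ e]
  congr 1
  ext u'
  obtain ⟨u, rfl⟩ := e.surjective u'
  rw [LinearEquiv.conj_apply_apply, LinearEquiv.symm_apply_apply, he', he']
  exact h.map_curvature hG hH hy u v w

end IsIsometryOn

end Local

/-! ### Uniqueness for autonomous ordinary differential equations on intervals -/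

/-- A C¹ field is Lipschitz near the initial value and both solutions stay there for a short time.
As `t₀` may be an endpoint of `I`, derivatives are taken within `I` and the two sides of `t₀` are
treated separately. -/
theorem eventuallyEq_of_hasDerivWithinAt {X : Type*} [NormedAddCommGroup X] [NormedSpace ℝ X]
    {v : X → X} {f g : ℝ → X} {I : Set ℝ} {t₀ : ℝ} (hI : I.OrdConnected) (ht₀ : t₀ ∈ I)
    (hv : ContDiffAt ℝ 1 v (f t₀))
    (hf : ∀ᶠ s in 𝓝[I] t₀, HasDerivWithinAt f (v (f s)) I s)
    (hg : ∀ᶠ s in 𝓝[I] t₀, HasDerivWithinAt g (v (g s)) I s) (h₀ : f t₀ = g t₀) :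
    ∀ᶠ s in 𝓝[I] t₀, f s = g s := by
  obtain ⟨K, N, hN, hK⟩ := hv.exists_lipschitzOnWith
  have hfN : ∀ᶠ s in 𝓝[I] t₀, f s ∈ N :=
    (hf.self_of_nhdsWithin ht₀).continuousWithinAt.eventually hN
  have hgN : ∀ᶠ s in 𝓝[I] t₀, g s ∈ N :=
    (hg.self_of_nhdsWithin ht₀).continuousWithinAt.eventually (h₀ ▸ hN)
  obtain ⟨δ, hδ, hball⟩ := Metric.mem_nhdsWithin_iff.1 ((hf.and hg).and (hfN.and hgN))
  filter_upwards [self_mem_nhdsWithin, mem_nhdsWithin_of_mem_nhds (Metric.ball_mem_nhds t₀ hδ)]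
    with s hsI hsδ
  have hsub : ∀ r ∈ Set.uIcc t₀ s, r ∈ Metric.ball t₀ δ ∩ I := fun r hr =>
    ⟨((convex_ball t₀ δ).ordConnected.uIcc_subset (Metric.mem_ball_self hδ) hsδ) hr,
      hI.uIcc_subset ht₀ hsI hr⟩
  rcases le_total t₀ s with hs | hs
  · rw [Set.uIcc_of_le hs] at hsub
    have hI' : Set.Icc t₀ s ⊆ I := fun r hr => (hsub r hr).2
    -- To the left of `s`, `I` contains a right neighbourhood of `r`, so a derivative within `I` is
    -- a right derivative.
    have hmem : ∀ r ∈ Set.Ico t₀ s, I ∈ 𝓝[≥] r := fun r hr =>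
      Filter.mem_of_superset (Icc_mem_nhdsGE hr.2) fun q hq => hI' ⟨hr.1.trans hq.1, hq.2⟩
    refine ODE_solution_unique_of_mem_Icc_right (v := fun _ => v) (s := fun _ => N) (K := K)
      (fun _ _ => hK)
      (fun r hr => ((hball (hsub r hr)).1.1.continuousWithinAt.mono hI'))
      (fun r hr => (hball (hsub r ⟨hr.1, hr.2.le⟩)).1.1.mono_of_mem_nhdsWithin (hmem r hr))
      (fun r hr => (hball (hsub r ⟨hr.1, hr.2.le⟩)).2.1)
      (fun r hr => ((hball (hsub r hr)).1.2.continuousWithinAt.mono hI'))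
      (fun r hr => (hball (hsub r ⟨hr.1, hr.2.le⟩)).1.2.mono_of_mem_nhdsWithin (hmem r hr))
      (fun r hr => (hball (hsub r ⟨hr.1, hr.2.le⟩)).2.2) h₀ (Set.right_mem_Icc.2 hs)
  · rw [Set.uIcc_of_ge hs] at hsub
    have hI' : Set.Icc s t₀ ⊆ I := fun r hr => (hsub r hr).2
    have hmem : ∀ r ∈ Set.Ioc s t₀, I ∈ 𝓝[≤] r := fun r hr =>
      Filter.mem_of_superset (Icc_mem_nhdsLE hr.1) fun q hq => hI' ⟨hq.1, hq.2.trans hr.2⟩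
    refine ODE_solution_unique_of_mem_Icc_left (v := fun _ => v) (s := fun _ => N) (K := K)
      (fun _ _ => hK)
      (fun r hr => ((hball (hsub r hr)).1.1.continuousWithinAt.mono hI'))
      (fun r hr => (hball (hsub r ⟨hr.1.le, hr.2⟩)).1.1.mono_of_mem_nhdsWithin (hmem r hr))
      (fun r hr => (hball (hsub r ⟨hr.1.le, hr.2⟩)).2.1)
      (fun r hr => ((hball (hsub r hr)).1.2.continuousWithinAt.mono hI'))
      (fun r hr => (hball (hsub r ⟨hr.1.le, hr.2⟩)).1.2.mono_of_mem_nhdsWithin (hmem r hr))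
      (fun r hr => (hball (hsub r ⟨hr.1.le, hr.2⟩)).2.2) h₀ (Set.left_mem_Icc.2 hs)

/-! ### The equation of Ricci magnetic geodesics in a chart -/

section Local

variable {E : Type*} [NormedAddCommGroup E] [NormedSpace ℝ E]

/-- The equation of Ricci magnetic geodesics for the curve `c` in a vector space with the metric
`G` and the complex structure `T`, at time `t`. -/
def IsRMGAt (T : E →L[ℝ] E) (G : E → E →L[ℝ] E →L[ℝ] ℝ) (lam : ℝ) (I : Set ℝ) (c : ℝ → E)
    (t : ℝ) : Prop :=
  ∀ w, G (c t) (derivWithin (derivWithin c I) I t +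
      christoffel G (c t) (derivWithin c I t) (derivWithin c I t)) w =
    lam * ricci G (c t) (T (derivWithin c I t)) w

theorem eventually_differentiableWithinAt {c : ℝ → E} {I : Set ℝ} {t : ℝ} (ht : t ∈ I)
    (hc : ContDiffWithinAt ℝ ∞ c I t) : ∀ᶠ s in 𝓝[I] t, DifferentiableWithinAt ℝ c I s := by
  -- Smoothness of order `∞` at a point only spreads to neighbourhoods order by order, so a finite
  -- order is fixed first.
  have h := (hc.of_le (m := 2) (WithTop.coe_le_coe.2 le_top)).eventually (by simp)
  rw [Set.insert_eq_of_mem ht] at h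
  filter_upwards [h] with s hs using hs.differentiableWithinAt (by simp)

theorem contDiffWithinAt_derivWithin {c : ℝ → E} {I : Set ℝ} {t : ℝ} (hI : UniqueDiffOn ℝ I)
    (ht : t ∈ I) (hc : ContDiffWithinAt ℝ ∞ c I t) :
    ContDiffWithinAt ℝ ∞ (derivWithin c I) I t := by
  have h : ContDiffWithinAt ℝ ∞ (fderivWithin ℝ c I) I t := hc.fderivWithin_right hI (by simp) ht
  exact h.clm_apply contDiffWithinAt_const

variable {T : E →L[ℝ] E} {G H : E → E →L[ℝ] E →L[ℝ] ℝ}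
  {U V : Set E} {ψ : E → E} {lam : ℝ} {I : Set ℝ} {c : ℝ → E}
  {t : ℝ}

theorem derivWithin_comp_eq (h : IsIsometryOn G U H V ψ) (hU : IsOpen U)
    (hI : UniqueDiffOn ℝ I) (ht : t ∈ I) (hc : DifferentiableWithinAt ℝ c I t) (hct : c t ∈ U) :
    derivWithin (ψ ∘ c) I t = fderiv ℝ ψ (c t) (derivWithin c I t) :=
  ((h.hasFDerivAt hU hct).comp_hasDerivWithinAt t hc.hasDerivWithinAt).derivWithin (hI t ht)

variable [FiniteDimensional ℝ E]

/-- Holomorphic isometries map Ricci magnetic geodesics to Ricci magnetic geodesics. -/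
theorem IsRMGAt.comp (hG : IsMetricOn G U) (hH : IsMetricOn H V) (h : IsIsometryOn G U H V ψ)
    (hT : ∀ y ∈ U, ∀ u, fderiv ℝ ψ y (T u) = T (fderiv ℝ ψ y u))
    (hI : UniqueDiffOn ℝ I) (ht : t ∈ I) (hc : ContDiffWithinAt ℝ ∞ c I t) (hct : c t ∈ U)
    (hR : IsRMGAt T G lam I c t) : IsRMGAt T H lam I (ψ ∘ c) t := by
  have hU := hG.isOpen
  have h1 := derivWithin_comp_eq h hU hI ht (hc.differentiableWithinAt (by simp)) hct
  have hev : ∀ᶠ s in 𝓝[I] t, derivWithin (ψ ∘ c) I s = fderiv ℝ ψ (c s) (derivWithin c I s) := by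
    filter_upwards [eventually_differentiableWithinAt ht hc, self_mem_nhdsWithin,
      hc.continuousWithinAt.eventually (hU.mem_nhds hct)] with s hs hsI hsU
      using derivWithin_comp_eq h hU hI hsI hs hsU
  have hc1 := (hc.differentiableWithinAt (by simp)).hasDerivWithinAt
  have hc2 := ((contDiffWithinAt_derivWithin hI ht hc).differentiableWithinAt
    (by simp)).hasDerivWithinAt
  have h2 : derivWithin (derivWithin (ψ ∘ c) I) I t =
      fderiv ℝ (fderiv ℝ ψ) (c t) (derivWithin c I t) (derivWithin c I t) +
        fderiv ℝ ψ (c t) (derivWithin (derivWithin c I) I t) := by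
    rw [Filter.EventuallyEq.derivWithin_eq hev h1]
    exact (((h.hasFDerivAt_fderiv hU hct).comp_hasDerivWithinAt t hc1).clm_apply hc2).derivWithin
      (hI t ht)
  intro w'
  obtain ⟨w, rfl⟩ := h.surjective hG hct w'
  -- The `ψ''` term of the second derivative cancels the inhomogeneous term in the law for Γ:
  -- covariant acceleration is tensorial.
  have hkey : derivWithin (derivWithin (ψ ∘ c) I) I t +
      christoffel H ((ψ ∘ c) t) (derivWithin (ψ ∘ c) I t) (derivWithin (ψ ∘ c) I t) =
      fderiv ℝ ψ (c t) (derivWithin (derivWithin c I) I t +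
        christoffel G (c t) (derivWithin c I t) (derivWithin c I t)) := by
    rw [h1, h2, map_add, h.map_christoffel hG hH hct, Function.comp_apply]
    abel
  rw [hkey, h1, ← hT _ hct, Function.comp_apply, ← h.isometric _ hct, hR w,
    h.ricci_eq hG hH hct]

/-! ### The RMG equation as a first-order system on `E × E`, and its uniqueness theorem. -/

/-- The trace, as a continuous linear form on endomorphisms. -/
def traceCLM (E : Type*) [NormedAddCommGroup E] [NormedSpace ℝ E] [FiniteDimensional ℝ E] :
    (E →L[ℝ] E) →L[ℝ] ℝ :=
  LinearMap.toContinuousLinearMap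
    (LinearMap.trace ℝ E ∘ₗ ContinuousLinearMap.coeLM (R := ℝ) (S := ℝ) (M := E) (N₃ := E))

theorem ricci_eq_traceCLM (G : E → E →L[ℝ] E →L[ℝ] ℝ) (y v w : E) :
    ricci G y v w = traceCLM E (curvature G y v w) := rfl

/-- The covector `Ric(v, ·)`. -/
def ricciForm₁ (G : E → E →L[ℝ] E →L[ℝ] ℝ) (y v : E) : E →L[ℝ] ℝ :=
  LinearMap.toContinuousLinearMap
    { toFun := fun w => ricci G y v w
      map_add' := fun w w' => by
        rw [ricci_eq_traceCLM, ricci_eq_traceCLM, ricci_eq_traceCLM, ← map_add]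
        congr 1
        ext u
        simp only [curvature_apply, map_add, add_apply]
        abel
      map_smul' := fun r w => by
        rw [ricci_eq_traceCLM, ricci_eq_traceCLM, RingHom.id_apply, ← map_smul]
        congr 1
        ext u
        simp only [curvature_apply, map_smul, smul_apply, smul_add, smul_sub] }

theorem ricciForm₁_apply (G : E → E →L[ℝ] E →L[ℝ] ℝ) (y v w : E) :
    ricciForm₁ G y v w = ricci G y v w := rfl

theorem IsMetricOn.contDiffOn_ricciForm₁ (hG : IsMetricOn G U) :
    ContDiffOn ℝ ∞ (fun p : E × E => ricciForm₁ G p.1 p.2) (U ×ˢ Set.univ) := by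
  rw [contDiffOn_clm_apply]
  intro w
  refine (traceCLM E).contDiff.comp_contDiffOn (f := fun p : E × E => curvature G p.1 p.2 w) ?_
  rw [contDiffOn_clm_apply]
  intro u
  have hfst : Set.MapsTo (Prod.fst : E × E → E) (U ×ˢ Set.univ) U := fun p hp => hp.1
  have hΓ := hG.contDiffOn_christoffel.comp contDiffOn_fst hfst
  have hDΓ := (hG.contDiffOn_christoffel.fderiv_of_isOpen (m := ∞) hG.isOpen (by simp)).comp
    contDiffOn_fst hfst
  have hv : ContDiffOn ℝ ∞ (Prod.snd : E × E → E) (U ×ˢ Set.univ) := contDiffOn_snd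
  have hw : ContDiffOn ℝ ∞ (fun _ : E × E => w) (U ×ˢ Set.univ) := contDiffOn_const
  have hu : ContDiffOn ℝ ∞ (fun _ : E × E => u) (U ×ˢ Set.univ) := contDiffOn_const
  exact ((((hDΓ.clm_apply hu).clm_apply hv).clm_apply hw).sub
    (((hDΓ.clm_apply hv).clm_apply hu).clm_apply hw)).add
    ((hΓ.clm_apply hu).clm_apply ((hΓ.clm_apply hv).clm_apply hw)) |>.sub
    ((hΓ.clm_apply hv).clm_apply ((hΓ.clm_apply hu).clm_apply hw))

/-- The vector field on `E × E` whose integral curves are the Ricci magnetic geodesics with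
their velocities. -/
def rmgField (T : E →L[ℝ] E) (G : E → E →L[ℝ] E →L[ℝ] ℝ) (lam : ℝ) (p : E × E) : E × E :=
  (p.2, lam • (G p.1).inverse (ricciForm₁ G p.1 (T p.2)) - christoffel G p.1 p.2 p.2)

theorem IsMetricOn.contDiffOn_rmgField (hG : IsMetricOn G U) (T : E →L[ℝ] E) (lam : ℝ) :
    ContDiffOn ℝ ∞ (rmgField T G lam) (U ×ˢ Set.univ) := by
  have hfst : Set.MapsTo (Prod.fst : E × E → E) (U ×ˢ Set.univ) U := fun p hp => hp.1
  have hΓ := hG.contDiffOn_christoffel.comp contDiffOn_fst hfst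
  have hinv := hG.contDiffOn_inverse.comp contDiffOn_fst hfst
  have hv : ContDiffOn ℝ ∞ (Prod.snd : E × E → E) (U ×ˢ Set.univ) := contDiffOn_snd
  have hric := hG.contDiffOn_ricciForm₁.comp (f := fun p : E × E => (p.1, T p.2))
    (contDiffOn_fst.prodMk (T.contDiff.comp_contDiffOn hv)) (fun p hp => ⟨hp.1, trivial⟩)
  exact hv.prodMk (((hinv.clm_apply hric).const_smul lam).sub
    ((hΓ.clm_apply hv).clm_apply hv))

/-- Nondegeneracy of `G` solves the covector equation for the second derivative of `c`. -/
theorem IsRMGAt.hasDerivWithinAt (hG : IsMetricOn G U) (hI : UniqueDiffOn ℝ I) (ht : t ∈ I)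
    (hc : ContDiffWithinAt ℝ ∞ c I t) (hct : c t ∈ U) (hR : IsRMGAt T G lam I c t) :
    HasDerivWithinAt (fun s => (c s, derivWithin c I s))
      (rmgField T G lam (c t, derivWithin c I t)) I t := by
  have hc1 := (hc.differentiableWithinAt (by simp)).hasDerivWithinAt
  have hc2 := ((contDiffWithinAt_derivWithin hI ht hc).differentiableWithinAt
    (by simp)).hasDerivWithinAt
  have h : derivWithin (derivWithin c I) I t +
      christoffel G (c t) (derivWithin c I t) (derivWithin c I t) =
      lam • (G (c t)).inverse (ricciForm₁ G (c t) (T (derivWithin c I t))) := by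
    refine hG.ext_left hct fun w => ?_
    rw [hR w, map_smul, smul_apply, hG.apply_inverse hct, ricciForm₁_apply, smul_eq_mul]
  rw [rmgField, ← h, add_sub_cancel_right]
  exact hc1.prodMk hc2

/-- Uniqueness of Ricci magnetic geodesics with given initial velocity, in a chart. -/
theorem IsRMGAt.eventuallyEq (hG : IsMetricOn G U) (hI : UniqueDiffOn ℝ I)
    (hI' : I.OrdConnected) {c₁ c₂ : ℝ → E} (ht : t ∈ I) (hct : c₁ t ∈ U)
    (hc₁ : ∀ᶠ s in 𝓝[I] t, ContDiffWithinAt ℝ ∞ c₁ I s)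
    (hc₂ : ∀ᶠ s in 𝓝[I] t, ContDiffWithinAt ℝ ∞ c₂ I s)
    (hR₁ : ∀ᶠ s in 𝓝[I] t, IsRMGAt T G lam I c₁ s)
    (hR₂ : ∀ᶠ s in 𝓝[I] t, IsRMGAt T G lam I c₂ s)
    (h₀ : c₁ t = c₂ t) (h₁ : derivWithin c₁ I t = derivWithin c₂ I t) :
    ∀ᶠ s in 𝓝[I] t, c₁ s = c₂ s := by
  have hU₁ := (hc₁.self_of_nhdsWithin ht).continuousWithinAt.eventually (hG.isOpen.mem_nhds hct)
  have hU₂ := (hc₂.self_of_nhdsWithin ht).continuousWithinAt.eventually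
    (hG.isOpen.mem_nhds (h₀ ▸ hct))
  have hv : ContDiffAt ℝ 1 (rmgField T G lam) (c₁ t, derivWithin c₁ I t) :=
    ((hG.contDiffOn_rmgField T lam).contDiffAt
      ((hG.isOpen.prod isOpen_univ).mem_nhds ⟨hct, trivial⟩)).of_le
      (WithTop.coe_le_coe.2 le_top)
  have := eventuallyEq_of_hasDerivWithinAt (v := rmgField T G lam)
    (f := fun s => (c₁ s, derivWithin c₁ I s)) (g := fun s => (c₂ s, derivWithin c₂ I s))
    hI' ht hv
    (by filter_upwards [hc₁, hR₁, hU₁, self_mem_nhdsWithin] with s h1 h2 h3 h4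
          using h2.hasDerivWithinAt hG hI h4 h1 h3)
    (by filter_upwards [hc₂, hR₂, hU₂, self_mem_nhdsWithin] with s h1 h2 h3 h4
          using h2.hasDerivWithinAt hG hI h4 h1 h3)
    (by rw [h₀, h₁])
  filter_upwards [this] with s hs using congrArg Prod.fst hs

end Local

/-! ### Kähler manifolds in charts -/

section Manifold

variable {E : Type*} [NormedAddCommGroup E] [NormedSpace ℂ E]
  {M : Type*} [TopologicalSpace M] [ChartedSpace E M]

/-- The differential of the inverse of the preferred chart at `x`. -/
def chartDeriv (x : M) (y : E) : E →L[ℝ] E :=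
  mfderiv 𝓘(ℝ, E) 𝓘(ℝ, E) (extChartAt 𝓘(ℝ, E) x).symm y

/-- The differential of a self-map of `M`, with the tangent spaces identified with `E`. -/
def modelDeriv (φ : M → M) (p : M) : E →L[ℝ] E :=
  mfderiv 𝓘(ℝ, E) 𝓘(ℝ, E) φ p

/-- A bilinear form on the tangent bundle, with the tangent spaces identified with `E`. -/
def modelForm (b : ∀ x : M, TangentSpace 𝓘(ℝ, E) x →L[ℝ] TangentSpace 𝓘(ℝ, E) x →L[ℝ] ℝ)
    (p : M) : E →L[ℝ] E →L[ℝ] ℝ :=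
  b p

theorem inChart_apply
    (b : ∀ x : M, TangentSpace 𝓘(ℝ, E) x →L[ℝ] TangentSpace 𝓘(ℝ, E) x →L[ℝ] ℝ)
    (x : M) (y u v : E) :
    inChart b x y u v =
      modelForm b ((extChartAt 𝓘(ℝ, E) x).symm y) (chartDeriv x y u) (chartDeriv x y v) :=
  rfl

/-! ### Self-maps and metrics read in preferred charts. -/

/-- The coordinate expression of a self-map of `M` in the preferred charts at `x₀` and `x₁`. -/
def inCharts (φ : M → M) (x₀ x₁ : M) : E → E :=
  extChartAt 𝓘(ℝ, E) x₁ ∘ φ ∘ (extChartAt 𝓘(ℝ, E) x₀).symm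

/-- The domain of `inCharts φ x₀ x₁`. -/
def inChartsSource (φ : M → M) (x₀ x₁ : M) : Set E :=
  (extChartAt 𝓘(ℝ, E) x₀).target ∩
    (extChartAt 𝓘(ℝ, E) x₀).symm ⁻¹' (φ ⁻¹' (extChartAt 𝓘(ℝ, E) x₁).source)

theorem isOpen_inChartsSource {φ : M → M} (hφ : Continuous φ) (x₀ x₁ : M) :
    IsOpen (inChartsSource (E := E) φ x₀ x₁) :=
  (continuousOn_extChartAt_symm x₀).isOpen_inter_preimage (isOpen_extChartAt_target x₀)
    ((isOpen_extChartAt_source x₁).preimage hφ)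

theorem extChartAt_symm_inCharts {φ : M → M} {x₀ x₁ : M} {y : E}
    (hy : y ∈ inChartsSource φ x₀ x₁) :
    (extChartAt 𝓘(ℝ, E) x₁).symm (inCharts φ x₀ x₁ y) =
      φ ((extChartAt 𝓘(ℝ, E) x₀).symm y) :=
  (extChartAt 𝓘(ℝ, E) x₁).left_inv hy.2

theorem inCharts_mem_target {φ : M → M} {x₀ x₁ : M} {y : E} (hy : y ∈ inChartsSource φ x₀ x₁) :
    inCharts φ x₀ x₁ y ∈ (extChartAt 𝓘(ℝ, E) x₁).target :=
  (extChartAt 𝓘(ℝ, E) x₁).map_source hy.2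

variable [IsManifold 𝓘(ℂ, E) ω M]

theorem hasMFDerivAt_extChartAt_symm {x : M} {y : E} (hy : y ∈ (extChartAt 𝓘(ℝ, E) x).target) :
    HasMFDerivAt 𝓘(ℝ, E) 𝓘(ℝ, E) (extChartAt 𝓘(ℝ, E) x).symm y
      (chartDeriv (E := E) x y) := by
  have h := mdifferentiableWithinAt_extChartAt_symm (I := 𝓘(ℝ, E)) hy
  rw [ModelWithCorners.range_eq_univ, mdifferentiableWithinAt_univ] at h
  exact h.hasMFDerivAt

theorem chartDeriv_injective {x : M} {y : E} (hy : y ∈ (extChartAt 𝓘(ℝ, E) x).target) :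
    Function.Injective (chartDeriv x y) := by
  have h := isInvertible_mfderivWithin_extChartAt_symm (I := 𝓘(ℝ, E)) hy
  rw [ModelWithCorners.range_eq_univ, mfderivWithin_univ] at h
  exact h.injective

/-- Read in the preferred chart at the image point, the inverse chart is a transition map of the
complex atlas, so its real differential is complex linear. -/
theorem chartDeriv_mulI {x : M} {y : E} (hy : y ∈ (extChartAt 𝓘(ℝ, E) x).target) (u : E) :
    chartDeriv x y (mulI E u) = mulI E (chartDeriv x y u) := by
  have h1 : chartDeriv x y = fderiv ℝ
      ((chartAt E ((chartAt E x).symm y)) ∘ (chartAt E x).symm) y := by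
    have h : chartDeriv x y = fderivWithin ℝ (writtenInExtChartAt 𝓘(ℝ, E) 𝓘(ℝ, E) y
        (extChartAt 𝓘(ℝ, E) x).symm) (Set.range 𝓘(ℝ, E)) (extChartAt 𝓘(ℝ, E) y y) :=
      (hasMFDerivAt_extChartAt_symm hy).mdifferentiableAt.mfderiv
    rw [h, ModelWithCorners.range_eq_univ, fderivWithin_univ]
    rfl
  have hy' : y ∈ (chartAt E x).target := by simpa using hy
  have h2 : DifferentiableAt ℂ ((chartAt E ((chartAt E x).symm y)) ∘ (chartAt E x).symm) y := by
    have h := (contDiffGroupoid ω 𝓘(ℂ, E)).compatible (chart_mem_atlas E x)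
      (chart_mem_atlas E ((chartAt E x).symm y))
    have h3 := (mem_groupoid_of_pregroupoid.1 h).1
    have h4 : ContDiffOn ℂ ω ((chartAt E ((chartAt E x).symm y)) ∘ (chartAt E x).symm)
        ((chartAt E x).symm.trans (chartAt E ((chartAt E x).symm y))).source := by
      have h5 : ContDiffOn ℂ ω (𝓘(ℂ, E) ∘ _ ∘ 𝓘(ℂ, E).symm) (𝓘(ℂ, E).symm ⁻¹' _ ∩ Set.range 𝓘(ℂ, E)) :=
        h3
      simpa using h5
    refine (h4.contDiffAt (((chartAt E x).symm.trans _).open_source.mem_nhds ?_)).differentiableAt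
      (by simp)
    simp [hy']
  rw [h1, h2.fderiv_restrictScalars ℝ]
  simp [mulI]

/-- This is the tangent map of the inverse chart applied to a constant vector field. -/
theorem contMDiffOn_chartDeriv (x : M) (u : E) :
    ContMDiffOn 𝓘(ℝ, E) (𝓘(ℝ, E).prod 𝓘(ℝ, E)) ∞
      (fun y => (⟨(extChartAt 𝓘(ℝ, E) x).symm y, chartDeriv x y u⟩ : TangentBundle 𝓘(ℝ, E) M))
      (extChartAt 𝓘(ℝ, E) x).target := by
  have hopen : IsOpen (extChartAt 𝓘(ℝ, E) x).target := isOpen_extChartAt_target x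
  have h := (contMDiffOn_extChartAt_symm (I := 𝓘(ℝ, E)) (n := ∞) x).contMDiffOn_tangentMapWithin
    (m := ∞) (by simp) hopen.uniqueMDiffOn
  have hconst : ContMDiff 𝓘(ℝ, E) (𝓘(ℝ, E).prod 𝓘(ℝ, E)) ∞
      (fun y : E => (⟨y, u⟩ : TangentBundle 𝓘(ℝ, E) E)) :=
    contMDiff_vectorSpace_iff_contDiff (V := fun _ : E => u).2 contDiff_const
  refine (h.comp hconst.contMDiffOn fun y hy => hy).congr fun y hy => ?_
  simp only [Function.comp_apply, tangentMapWithin]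
  rw [mfderivWithin_of_isOpen hopen hy]
  rfl

theorem modelForm_symm (g : KaehlerMetric E M) (p : M) (u v : E) :
    modelForm g.inner p u v = modelForm g.inner p v u :=
  g.symm p u v

theorem modelForm_pos (g : KaehlerMetric E M) (p : M) {u : E} (hu : u ≠ 0) :
    0 < modelForm g.inner p u u :=
  g.pos p u hu

theorem contDiffOn_inChart_apply (g : KaehlerMetric E M) (x : M) (u v : E) :
    ContDiffOn ℝ ∞ (fun y => inChart g.inner x y u v) (extChartAt 𝓘(ℝ, E) x).target := by
  rw [← contMDiffOn_iff_contDiffOn]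
  have h : ContMDiffOn 𝓘(ℝ, E) (𝓘(ℝ, E).prod 𝓘(ℝ)) ∞
      (fun y => Bundle.TotalSpace.mk' ℝ (E := Bundle.Trivial M ℝ)
        ((extChartAt 𝓘(ℝ, E) x).symm y)
        (g.inner ((extChartAt 𝓘(ℝ, E) x).symm y) (chartDeriv x y u) (chartDeriv x y v)))
      (extChartAt 𝓘(ℝ, E) x).target := by
    refine ContMDiffOn.clm_bundle_apply₂ (F₁ := E) (F₂ := E) ?_ (contMDiffOn_chartDeriv x u)
      (contMDiffOn_chartDeriv x v)
    exact g.contMDiff.comp_contMDiffOn (contMDiffOn_extChartAt_symm x)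
  intro y hy
  have h1 := h y hy
  rw [Bundle.contMDiffWithinAt_totalSpace] at h1
  exact h1.2

theorem contDiffOn_inCharts {φ : M → M} (hφ : ContMDiff 𝓘(ℝ, E) 𝓘(ℝ, E) ∞ φ) (x₀ x₁ : M) :
    ContDiffOn ℝ ∞ (inCharts (E := E) φ x₀ x₁) (inChartsSource φ x₀ x₁) := by
  rw [← contMDiffOn_iff_contDiffOn]
  have h0 := (contMDiffOn_extChartAt_symm (I := 𝓘(ℝ, E)) (n := ∞) x₀).mono
    (Set.inter_subset_left : inChartsSource φ x₀ x₁ ⊆ _)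
  have h1 := contMDiffOn_extChartAt (I := 𝓘(ℝ, E)) (n := ∞) (x := x₁)
  refine h1.comp (hφ.comp_contMDiffOn h0) fun y hy => ?_
  have := hy.2
  simpa using this

/-- Chain rule on both sides of the commuting square formed by `φ` and the inverse charts. -/
theorem chartDeriv_inCharts {φ : M → M} (hφ : ContMDiff 𝓘(ℝ, E) 𝓘(ℝ, E) ∞ φ) {x₀ x₁ : M} {y : E}
    (hy : y ∈ inChartsSource φ x₀ x₁) (u : E) :
    chartDeriv x₁ (inCharts φ x₀ x₁ y) (fderiv ℝ (inCharts φ x₀ x₁) y u) =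
      modelDeriv φ ((extChartAt 𝓘(ℝ, E) x₀).symm y) (chartDeriv x₀ y u) := by
  have hopen := (isOpen_inChartsSource (E := E) hφ.continuous x₀ x₁).mem_nhds hy
  have hψ : HasMFDerivAt 𝓘(ℝ, E) 𝓘(ℝ, E) (inCharts φ x₀ x₁) y
      (fderiv ℝ (inCharts (E := E) φ x₀ x₁) y) :=
    (((contDiffOn_inCharts hφ x₀ x₁).contDiffAt hopen).differentiableAt
      (by simp)).hasFDerivAt.hasMFDerivAt
  have h1 : HasMFDerivAt 𝓘(ℝ, E) 𝓘(ℝ, E) (extChartAt 𝓘(ℝ, E) x₁).symm (inCharts φ x₀ x₁ y)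
      (chartDeriv (E := E) x₁ (inCharts φ x₀ x₁ y)) :=
    hasMFDerivAt_extChartAt_symm (inCharts_mem_target hy)
  have hφ' : HasMFDerivAt 𝓘(ℝ, E) 𝓘(ℝ, E) φ ((extChartAt 𝓘(ℝ, E) x₀).symm y)
      (modelDeriv (E := E) φ ((extChartAt 𝓘(ℝ, E) x₀).symm y)) :=
    (hφ.mdifferentiableAt (by simp)).hasMFDerivAt
  have hl := h1.comp y hψ
  have hr := hφ'.comp y (hasMFDerivAt_extChartAt_symm (x := x₀) hy.1)
  have heq : φ ∘ (extChartAt 𝓘(ℝ, E) x₀).symm =ᶠ[𝓝 y]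
      (extChartAt 𝓘(ℝ, E) x₁).symm ∘ inCharts φ x₀ x₁ := by
    filter_upwards [hopen] with z hz using (extChartAt_symm_inCharts hz).symm
  have := hasMFDerivAt_unique hr (hl.congr_of_eventuallyEq heq)
  exact (congrArg (fun L : E →L[ℝ] E => L u) this).symm

theorem IsHolomorphicIsometric.isIsometryOn {g : KaehlerMetric E M} {φ : M → M}
    (hφ : IsHolomorphicIsometric g g φ) (x₀ x₁ : M) :
    IsIsometryOn (inChart g.inner x₀) (inChartsSource φ x₀ x₁) (inChart g.inner x₁)
      (extChartAt 𝓘(ℝ, E) x₁).target (inCharts φ x₀ x₁) where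
  smooth := contDiffOn_inCharts hφ.smooth x₀ x₁
  mapsTo _ hy := inCharts_mem_target hy
  isometric y hy u v := by
    rw [inChart_apply, inChart_apply, chartDeriv_inCharts hφ.smooth hy,
      chartDeriv_inCharts hφ.smooth hy, extChartAt_symm_inCharts hy]
    exact (hφ.isometric _ _ _).symm

/-- `φ` commutes with the complex structure on tangent spaces, and the chart differentials are
injective and complex linear. -/
theorem IsHolomorphicIsometric.fderiv_mulI {g : KaehlerMetric E M} {φ : M → M}
    (hφ : IsHolomorphicIsometric g g φ) {x₀ x₁ : M} {y : E} (hy : y ∈ inChartsSource φ x₀ x₁)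
    (u : E) :
    fderiv ℝ (inCharts φ x₀ x₁) y (mulI E u) = mulI E (fderiv ℝ (inCharts φ x₀ x₁) y u) := by
  refine chartDeriv_injective (inCharts_mem_target hy) ?_
  rw [chartDeriv_mulI (inCharts_mem_target hy), chartDeriv_inCharts hφ.smooth hy,
    chartDeriv_inCharts hφ.smooth hy, chartDeriv_mulI hy.1]
  exact hφ.holomorphic _ _

variable [FiniteDimensional ℂ E]

theorem contDiffOn_inChart (g : KaehlerMetric E M) (x : M) :
    ContDiffOn ℝ ∞ (inChart g.inner x) (extChartAt 𝓘(ℝ, E) x).target := by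
  rw [contDiffOn_clm_apply]
  intro u
  rw [contDiffOn_clm_apply]
  exact contDiffOn_inChart_apply g x u

theorem isMetricOn_inChart (g : KaehlerMetric E M) (x : M) :
    IsMetricOn (inChart g.inner x) (extChartAt 𝓘(ℝ, E) x).target where
  isOpen := isOpen_extChartAt_target x
  smooth := contDiffOn_inChart g x
  symm y _ u v := by
    rw [inChart_apply, inChart_apply, modelForm_symm]
  pos y hy u hu := by
    rw [inChart_apply]
    refine modelForm_pos g _ fun h => hu (chartDeriv_injective hy ?_)
    rw [h, map_zero]

end Manifold

/-! ### Ricci magnetic geodesics and holomorphic isometries -/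

theorem uniqueDiffOn_of_ordConnected {I : Set ℝ} (hI : I.OrdConnected) (h : I.Nontrivial) :
    UniqueDiffOn ℝ I := by
  obtain ⟨a, ha, b, hb, hab⟩ := h.exists_lt
  exact uniqueDiffOn_convex hI.convex
    ⟨_, interior_mono (hI.out ha hb) (by rw [interior_Icc]; exact (Set.nonempty_Ioo.2 hab).some_mem)⟩

section Local

variable {E : Type*} [NormedAddCommGroup E] [NormedSpace ℝ E]

theorem eventuallyEq_derivWithin {c₁ c₂ : ℝ → E} {I : Set ℝ} {t : ℝ}
    (h : ∀ᶠ s in 𝓝[I] t, c₁ s = c₂ s) :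
    ∀ᶠ s in 𝓝[I] t, derivWithin c₁ I s = derivWithin c₂ I s := by
  filter_upwards [eventually_eventually_nhdsWithin.2 h, h] with s hs hs'
    using Filter.EventuallyEq.derivWithin_eq hs hs'

theorem IsRMGAt.congr {T : E →L[ℝ] E} {G : E → E →L[ℝ] E →L[ℝ] ℝ}
    {lam : ℝ} {I : Set ℝ} {c₁ c₂ : ℝ → E} {t : ℝ} (ht : t ∈ I)
    (h : ∀ᶠ s in 𝓝[I] t, c₁ s = c₂ s) (hR : IsRMGAt T G lam I c₁ t) :
    IsRMGAt T G lam I c₂ t := by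
  have h1 := eventuallyEq_derivWithin h
  have h2 := eventuallyEq_derivWithin h1
  intro w
  have := hR w
  rwa [h.self_of_nhdsWithin ht, h1.self_of_nhdsWithin ht, h2.self_of_nhdsWithin ht] at this

end Local

section Manifold

variable {E : Type*} [NormedAddCommGroup E] [NormedSpace ℂ E]
  {M : Type*} [TopologicalSpace M] [ChartedSpace E M]

theorem velocity_eq_derivWithin {I : Set ℝ} {α : ℝ → M} {t : ℝ}
    (hα : MDifferentiableWithinAt 𝓘(ℝ, ℝ) 𝓘(ℝ, E) α I t) :
    velocity I α t = derivWithin (extChartAt 𝓘(ℝ, E) (α t) ∘ α) I t := by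
  rw [velocity, hα.mfderivWithin]
  simp [writtenInExtChartAt, derivWithin]
  rfl

theorem inCharts_extChartAt {φ : M → M} {x₀ x₁ p : M} (hp : p ∈ (extChartAt 𝓘(ℝ, E) x₀).source) :
    inCharts φ x₀ x₁ (extChartAt 𝓘(ℝ, E) x₀ p) = extChartAt 𝓘(ℝ, E) x₁ (φ p) := by
  simp only [inCharts, Function.comp_apply]
  rw [(extChartAt 𝓘(ℝ, E) x₀).left_inv hp]

theorem extChartAt_mem_inChartsSource {φ : M → M} {x : M} (hx : φ x = x) :
    extChartAt 𝓘(ℝ, E) x x ∈ inChartsSource φ x x := by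
  refine ⟨mem_extChartAt_target x, ?_⟩
  rw [Set.mem_preimage, (extChartAt 𝓘(ℝ, E) x).left_inv (mem_extChartAt_source x),
    Set.mem_preimage, hx]
  exact mem_extChartAt_source x

variable [IsManifold 𝓘(ℂ, E) ω M]

/-- At its own base point the preferred chart is the one identifying the tangent space with `E`, so
`inChart` gives back the metric itself there. -/
theorem chartDeriv_self (x : M) :
    chartDeriv x (extChartAt 𝓘(ℝ, E) x x) = ContinuousLinearMap.id ℝ E := by
  have h := mfderivWithin_range_extChartAt_symm (I := 𝓘(ℝ, E)) (x := x)
  rw [ModelWithCorners.range_eq_univ, mfderivWithin_univ] at h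
  exact h

theorem contDiffWithinAt_extChartAt_comp {I : Set ℝ} {β : ℝ → M} {x : M} {t : ℝ}
    (hβ : ContMDiffWithinAt 𝓘(ℝ, ℝ) 𝓘(ℝ, E) ∞ β I t)
    (hx : β t ∈ (extChartAt 𝓘(ℝ, E) x).source) :
    ContDiffWithinAt ℝ ∞ (extChartAt 𝓘(ℝ, E) x ∘ β) I t := by
  rw [← contMDiffWithinAt_iff_contDiffWithinAt]
  exact (contMDiffAt_extChartAt' (by simpa using hx)).comp_contMDiffWithinAt t hβ

variable {g : KaehlerMetric E M} {lam : ℝ} {I : Set ℝ} {α : ℝ → M}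

/-- `IsRMG` uses a different chart at each time. `IsRMG.isRMGAt_comp` applied to the identity moves
the equation to one fixed chart, where ODE uniqueness applies. -/
theorem isHolomorphicIsometric_id (g : KaehlerMetric E M) : IsHolomorphicIsometric g g id where
  smooth := contMDiff_id
  holomorphic x u := by rw [mfderiv_id]; rfl
  isometric x u v := by rw [mfderiv_id]; rfl

theorem IsRMG.isRMGAt_self (hα : IsRMG g lam I α) {t : ℝ} (ht : t ∈ I) :
    IsRMGAt (mulI E) (inChart g.inner (α t)) lam I (extChartAt 𝓘(ℝ, E) (α t) ∘ α) t := by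
  have hv := velocity_eq_derivWithin ((hα.smooth t ht).mdifferentiableWithinAt (by simp))
  intro w
  rw [inChart_apply]
  have h : modelForm g.inner (α t) (acceleration g I α t) w =
      lam * ricci (inChart g.inner (α t)) (extChartAt 𝓘(ℝ, E) (α t) (α t))
        (mulI E (velocity I α t)) w := hα.eq t ht w
  rw [hv] at h
  simp only [Function.comp_apply]
  rw [chartDeriv_self, (extChartAt 𝓘(ℝ, E) (α t)).left_inv (mem_extChartAt_source (α t))]
  exact h

/-- The action of the differential of a holomorphic isometry on the velocity of a curve, in the
chart at a fixed point. -/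
theorem IsHolomorphicIsometric.fderiv_inCharts_derivWithin {φ : M → M}
    (hφ : IsHolomorphicIsometric g g φ) {β : ℝ → M} {t : ℝ} (hI : UniqueDiffOn ℝ I)
    (ht : t ∈ I) (hβ : ContMDiffWithinAt 𝓘(ℝ, ℝ) 𝓘(ℝ, E) ∞ β I t) (hfix : φ (β t) = β t) :
    fderiv ℝ (inCharts φ (β t) (β t)) (extChartAt 𝓘(ℝ, E) (β t) (β t))
      (derivWithin (extChartAt 𝓘(ℝ, E) (β t) ∘ β) I t) =
    derivWithin (extChartAt 𝓘(ℝ, E) (β t) ∘ φ ∘ β) I t := by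
  have hsrc := mem_extChartAt_source (I := 𝓘(ℝ, E)) (β t)
  refine (derivWithin_comp_eq (c := extChartAt 𝓘(ℝ, E) (β t) ∘ β)
    (hφ.isIsometryOn (β t) (β t))
    (isOpen_inChartsSource (E := E) hφ.smooth.continuous (β t) (β t)) hI ht
    ((contDiffWithinAt_extChartAt_comp hβ hsrc).differentiableWithinAt (by simp))
    (extChartAt_mem_inChartsSource hfix)).symm.trans ?_
  refine (eventuallyEq_derivWithin ?_).self_of_nhdsWithin ht
  filter_upwards [hβ.continuousWithinAt.eventually
    ((isOpen_extChartAt_source (I := 𝓘(ℝ, E)) (β t)).mem_nhds hsrc)] with s hs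
  exact inCharts_extChartAt hs

variable [FiniteDimensional ℂ E]

/-- The image of a Ricci magnetic geodesic by a holomorphic isometry is a Ricci magnetic geodesic
in every preferred chart. -/
theorem IsRMG.isRMGAt_comp (hα : IsRMG g lam I α) (hI : UniqueDiffOn ℝ I) {φ : M → M}
    (hφ : IsHolomorphicIsometric g g φ) {t : ℝ} (ht : t ∈ I) {x : M}
    (hx : φ (α t) ∈ (extChartAt 𝓘(ℝ, E) x).source) :
    IsRMGAt (mulI E) (inChart g.inner x) lam I (extChartAt 𝓘(ℝ, E) x ∘ φ ∘ α) t := by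
  have hsrc := mem_extChartAt_source (I := 𝓘(ℝ, E)) (α t)
  have hmem : extChartAt 𝓘(ℝ, E) (α t) (α t) ∈ inChartsSource φ (α t) x := by
    refine ⟨mem_extChartAt_target (α t), ?_⟩
    rw [Set.mem_preimage, (extChartAt 𝓘(ℝ, E) (α t)).left_inv hsrc]
    exact hx
  have hG := (isMetricOn_inChart g (α t)).mono
    (isOpen_inChartsSource (E := E) hφ.smooth.continuous (α t) x) Set.inter_subset_left
  refine ((hα.isRMGAt_self ht).comp hG (isMetricOn_inChart g x) (hφ.isIsometryOn (α t) x)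
    (fun y hy u => hφ.fderiv_mulI hy u) hI ht
    (contDiffWithinAt_extChartAt_comp (hα.smooth t ht) hsrc) hmem).congr ht ?_
  filter_upwards [(hα.smooth t ht).continuousWithinAt.eventually
    ((isOpen_extChartAt_source (I := 𝓘(ℝ, E)) (α t)).mem_nhds hsrc)] with s hs
  simp only [inCharts, Function.comp_apply]
  rw [(extChartAt 𝓘(ℝ, E) (α t)).left_inv hs]

/-- A Ricci magnetic geodesic whose velocity at some time is fixed by a holomorphic isometry is
fixed at nearby times. -/
theorem IsRMG.eventually_fixed (hα : IsRMG g lam I α) (hI : UniqueDiffOn ℝ I)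
    (hI' : I.OrdConnected) {φ : M → M} (hφ : IsHolomorphicIsometric g g φ) {t : ℝ} (ht : t ∈ I)
    (h₀ : φ (α t) = α t)
    (h₁ : derivWithin (extChartAt 𝓘(ℝ, E) (α t) ∘ φ ∘ α) I t =
      derivWithin (extChartAt 𝓘(ℝ, E) (α t) ∘ α) I t) :
    ∀ᶠ s in 𝓝[I] t, φ (α s) = α s := by
  have hsrc := mem_extChartAt_source (I := 𝓘(ℝ, E)) (α t)
  have hopen := isOpen_extChartAt_source (I := 𝓘(ℝ, E)) (α t)
  have hev₁ : ∀ᶠ s in 𝓝[I] t, α s ∈ (extChartAt 𝓘(ℝ, E) (α t)).source :=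
    (hα.smooth t ht).continuousWithinAt.eventually (hopen.mem_nhds hsrc)
  have hφα : ContMDiffOn 𝓘(ℝ, ℝ) 𝓘(ℝ, E) ∞ (φ ∘ α) I := hφ.smooth.comp_contMDiffOn hα.smooth
  have hev₂ : ∀ᶠ s in 𝓝[I] t, φ (α s) ∈ (extChartAt 𝓘(ℝ, E) (α t)).source :=
    (hφα t ht).continuousWithinAt.eventually (hopen.mem_nhds (by
      rw [Function.comp_apply, h₀]; exact hsrc))
  have key := IsRMGAt.eventuallyEq (T := mulI E) (lam := lam)
    (c₁ := extChartAt 𝓘(ℝ, E) (α t) ∘ φ ∘ α) (c₂ := extChartAt 𝓘(ℝ, E) (α t) ∘ α)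
    (isMetricOn_inChart g (α t)) hI hI' ht
    (by rw [Function.comp_apply, Function.comp_apply, h₀]; exact mem_extChartAt_target (α t))
    (by filter_upwards [hev₂, self_mem_nhdsWithin] with s hs hsI
          using contDiffWithinAt_extChartAt_comp (hφα s hsI) hs)
    (by filter_upwards [hev₁, self_mem_nhdsWithin] with s hs hsI
          using contDiffWithinAt_extChartAt_comp (hα.smooth s hsI) hs)
    (by filter_upwards [hev₂, self_mem_nhdsWithin] with s hs hsI
          using hα.isRMGAt_comp hI hφ hsI hs)
    (by filter_upwards [hev₁, self_mem_nhdsWithin] with s hs hsI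
          using hα.isRMGAt_comp hI (isHolomorphicIsometric_id g) hsI hs)
    (by simp only [Function.comp_apply, h₀]) h₁
  filter_upwards [key, hev₁, hev₂] with s hs h1 h2
    using (extChartAt 𝓘(ℝ, E) (α t)).injOn h2 h1 hs

/-- A Ricci magnetic geodesic which is fixed by a holomorphic isometry near some time is fixed. -/
theorem IsRMG.fixed [T2Space M] (hα : IsRMG g lam I α) (hI : UniqueDiffOn ℝ I)
    (hI' : I.OrdConnected) {φ : M → M} (hφ : IsHolomorphicIsometric g g φ) {t₀ : ℝ} (ht₀ : t₀ ∈ I)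
    (h₀ : ∀ᶠ s in 𝓝[I] t₀, φ (α s) = α s) {t : ℝ} (ht : t ∈ I) : φ (α t) = α t := by
  -- Coincidence near `t`, not just at `t`: this is open by construction. It is closed because
  -- limits of such times have equal positions (`M` is Hausdorff) and equal velocities, so that
  -- uniqueness restarts there.
  let Q : ℝ → Prop := fun t => ∀ᶠ s in 𝓝[I] t, φ (α s) = α s
  have hφα : ContMDiffOn 𝓘(ℝ, ℝ) 𝓘(ℝ, E) ∞ (φ ∘ α) I := hφ.smooth.comp_contMDiffOn hα.smooth
  have hclosed : ∀ t ∈ I, (∃ᶠ s in 𝓝[I] t, Q s) → Q t := by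
    intro t ht hfr
    have hfr₀ : ∃ᶠ s in 𝓝[I] t, φ (α s) = α s :=
      (hfr.and_eventually self_mem_nhdsWithin).mono fun s hs => hs.1.self_of_nhdsWithin hs.2
    have hfix : φ (α t) = α t :=
      (isClosed_eq hφ.smooth.continuous continuous_id).mem_of_frequently_of_tendsto hfr₀
        (hα.smooth t ht).continuousWithinAt
    have hsrc := mem_extChartAt_source (I := 𝓘(ℝ, E)) (α t)
    refine hα.eventually_fixed hI hI' hφ ht hfix ?_
    have hc₁ := contDiffWithinAt_derivWithin hI ht
      (contDiffWithinAt_extChartAt_comp (hα.smooth t ht) hsrc)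
    have hc₂ := contDiffWithinAt_derivWithin hI ht
      (contDiffWithinAt_extChartAt_comp (x := α t) (hφα t ht) (by
        rw [Function.comp_apply, hfix]; exact hsrc))
    have hfr₁ : ∃ᶠ s in 𝓝[I] t, derivWithin (extChartAt 𝓘(ℝ, E) (α t) ∘ φ ∘ α) I s -
        derivWithin (extChartAt 𝓘(ℝ, E) (α t) ∘ α) I s = 0 :=
      (hfr.and_eventually self_mem_nhdsWithin).mono fun s hs => by
        rw [sub_eq_zero]
        refine (eventuallyEq_derivWithin ?_).self_of_nhdsWithin hs.2
        exact hs.1.mono fun r hr => congrArg (extChartAt 𝓘(ℝ, E) (α t)) hr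
    have := (isClosed_singleton (x := (0 : E))).mem_of_frequently_of_tendsto hfr₁
      (hc₂.continuousWithinAt.sub hc₁.continuousWithinAt)
    exact sub_eq_zero.1 this
  -- `Q` is locally constant on the preconnected set `I`.
  have hQ : Q t₀ ↔ Q t := by
    refine hI'.isPreconnected.induction₂ (fun a b => Q a ↔ Q b) (fun a ha => ?_)
      (fun a b c _ _ _ hab hbc => hab.trans hbc) (fun a b _ _ h => h.symm) ht₀ ht
    by_cases hQa : Q a
    · exact (eventually_eventually_nhdsWithin.2 hQa).mono fun b hb => ⟨fun _ => hb, fun _ => hQa⟩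
    · have := Filter.not_frequently.1 (mt (hclosed a ha) hQa)
      exact this.mono fun b hb => ⟨fun h => (hQa h).elim, fun h => (hb h).elim⟩
  exact (hQ.1 h₀).self_of_nhdsWithin ht

/-- Ricci magnetic geodesics tangent to a component of the fixed point set stay in it. -/
theorem IsRMG.mem_of_isTangentTo [T2Space M] (hα : IsRMG g lam I α)
    {G : Subgroup (Equiv.Perm M)} {S : Set M} (hG : IsGroupOfHolomorphicIsometries g G)
    (hS : IsFixedComponent G S) (hI : I.OrdConnected) (h0 : (0 : ℝ) ∈ I)
    (hT : IsTangentTo S (⟨α 0, velocity I α 0⟩ : TangentBundle 𝓘(ℝ, E) M)) {t : ℝ} (ht : t ∈ I) :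
    α t ∈ S := by
  obtain ⟨p, -, rfl⟩ := hS
  obtain ⟨ε, γ, hε, hγ, hγS, hγα⟩ := hT
  have h0J : (0 : ℝ) ∈ Set.Ioo (-ε) ε := ⟨neg_lt_zero.2 hε, hε⟩
  have hpt : γ 0 = α 0 := congrArg Bundle.TotalSpace.proj hγα
  have hα0 : α 0 ∈ connectedComponentIn (MulAction.fixedPoints G M) p := hpt ▸ hγS 0 h0J
  -- Derivatives within a one-point interval are not unique, but then `t = 0` and membership is
  -- already known.
  by_cases hnt : I.Nontrivial
  swap
  · rwa [Set.not_nontrivial_iff.1 hnt ht h0]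
  have hIu := uniqueDiffOn_of_ordConnected hI hnt
  have hγ0 := hγ 0 h0J
  have hvel : derivWithin (extChartAt 𝓘(ℝ, E) (γ 0) ∘ γ) (Set.Ioo (-ε) ε) 0 =
      derivWithin (extChartAt 𝓘(ℝ, E) (α 0) ∘ α) I 0 := by
    rw [← velocity_eq_derivWithin (hγ0.mdifferentiableWithinAt (by simp)),
      ← velocity_eq_derivWithin ((hα.smooth 0 h0).mdifferentiableWithinAt (by simp))]
    exact congrArg (fun v : TangentBundle 𝓘(ℝ, E) M => (v.2 : E)) hγα
  have hfix : ∀ φ ∈ G, ∀ s ∈ I, φ (α s) = α s := by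
    intro φ hφG s hs
    have hφ := hG φ hφG
    have hfixγ : ∀ s ∈ Set.Ioo (-ε) ε, φ (γ s) = γ s := fun s hs =>
      connectedComponentIn_subset _ _ (hγS s hs) ⟨φ, hφG⟩
    have h₀ : φ (α 0) = α 0 := hpt ▸ hfixγ 0 h0J
    refine hα.fixed hIu hI hφ h0 (hα.eventually_fixed hIu hI hφ h0 h₀ ?_) hs
    -- The differential of `φ` sees only the velocity, so `α` may be replaced by `γ`, on which `φ`
    -- is the identity.
    rw [← hφ.fderiv_inCharts_derivWithin hIu h0 (hα.smooth 0 h0) h₀, ← hvel, ← hpt,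
      hφ.fderiv_inCharts_derivWithin (uniqueDiffOn_Ioo _ _) h0J hγ0 (hfixγ 0 h0J)]
    refine (eventuallyEq_derivWithin ?_).self_of_nhdsWithin h0J
    filter_upwards [self_mem_nhdsWithin] with r hr
    rw [Function.comp_apply, Function.comp_apply, Function.comp_apply, hfixγ r hr]
  have hsub : α '' I ⊆ MulAction.fixedPoints G M := by
    rintro _ ⟨s, hs, rfl⟩ φ
    exact hfix φ φ.2 s hs
  rw [connectedComponentIn_eq hα0]
  exact (hI.isPreconnected.image α hα.smooth.continuousOn).subset_connectedComponentIn
    ⟨0, h0, rfl⟩ hsub ⟨t, ht, rfl⟩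

end Manifold

/-! ### Multiples and products of metrics -/

section Local

variable {E F : Type*} [NormedAddCommGroup E] [NormedSpace ℝ E]
  [NormedAddCommGroup F] [NormedSpace ℝ F]

theorem fderiv_apply_apply {V W X : Type*} [NormedAddCommGroup V] [NormedSpace ℝ V]
    [NormedAddCommGroup W] [NormedSpace ℝ W] [NormedAddCommGroup X] [NormedSpace ℝ X]
    {B : E → V →L[ℝ] W →L[ℝ] X} {y : E} (hB : DifferentiableAt ℝ B y) (u : V) (v : W) (a : E) :
    fderiv ℝ (fun z => B z u v) y a = fderiv ℝ B y a u v := by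
  have h := (hB.hasFDerivAt.clm_apply (hasFDerivAt_const u y)).clm_apply (hasFDerivAt_const v y)
  rw [h.fderiv]
  simp

theorem ricci_congr {G H : E → E →L[ℝ] E →L[ℝ] ℝ} (h : christoffel G = christoffel H) :
    ricci G = ricci H := by
  ext y v w
  rw [ricci, ricci, curvature, curvature, h]

theorem IsMetricOn.const_smul {G : E → E →L[ℝ] E →L[ℝ] ℝ} {U : Set E} (hG : IsMetricOn G U)
    {r : ℝ} (hr : 0 < r) : IsMetricOn (fun y => r • G y) U where
  isOpen := hG.isOpen
  smooth := hG.smooth.const_smul r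
  symm y hy u v := by simp [hG.symm y hy u v]
  pos y hy u hu := by simpa using mul_pos hr (hG.pos y hy u hu)

/-- The symbols of the first kind and the metric both scale by `r`. -/
theorem christoffel_const_smul [FiniteDimensional ℝ E] {G : E → E →L[ℝ] E →L[ℝ] ℝ}
    (hG : IsMetricOn G Set.univ) {r : ℝ} (hr : 0 < r) :
    christoffel (fun y => r • G y) = christoffel G := by
  ext y u v
  refine (hG.const_smul hr).christoffel_eq (Set.mem_univ y) fun w => ?_
  have hd := hG.differentiableAt (Set.mem_univ y)
  rw [christoffelFst_apply, fderiv_fun_const_smul hd]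
  simp only [smul_apply, smul_eq_mul]
  rw [hG.apply_christoffel (Set.mem_univ y), christoffelFst_apply]
  ring

/-- The product of two metrics. -/
def prodMetric (G : E → E →L[ℝ] E →L[ℝ] ℝ) (H : F → F →L[ℝ] F →L[ℝ] ℝ) (p : E × F) :
    E × F →L[ℝ] E × F →L[ℝ] ℝ :=
  (G p.1).bilinearComp (ContinuousLinearMap.fst ℝ E F) (ContinuousLinearMap.fst ℝ E F) +
    (H p.2).bilinearComp (ContinuousLinearMap.snd ℝ E F) (ContinuousLinearMap.snd ℝ E F)

theorem prodMetric_apply (G : E → E →L[ℝ] E →L[ℝ] ℝ) (H : F → F →L[ℝ] F →L[ℝ] ℝ) (p u v : E × F) :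
    prodMetric G H p u v = G p.1 u.1 v.1 + H p.2 u.2 v.2 := rfl

variable [FiniteDimensional ℝ E] [FiniteDimensional ℝ F]
  {G : E → E →L[ℝ] E →L[ℝ] ℝ} {H : F → F →L[ℝ] F →L[ℝ] ℝ}

theorem isMetricOn_prodMetric (hG : IsMetricOn G Set.univ) (hH : IsMetricOn H Set.univ) :
    IsMetricOn (prodMetric G H) Set.univ where
  isOpen := isOpen_univ
  smooth := by
    rw [contDiffOn_clm_apply]
    intro u
    rw [contDiffOn_clm_apply]
    intro v
    have h1 := hG.smooth.comp (t := Set.univ) (s := Set.univ) (contDiffOn_fst (F := F))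
      (Set.mapsTo_univ _ _)
    have h2 := hH.smooth.comp (t := Set.univ) (s := Set.univ) (contDiffOn_snd (E := E))
      (Set.mapsTo_univ _ _)
    exact ((h1.clm_apply contDiffOn_const).clm_apply contDiffOn_const).add
      ((h2.clm_apply contDiffOn_const).clm_apply contDiffOn_const)
  symm y _ u v := by
    rw [prodMetric_apply, prodMetric_apply, hG.symm y.1 trivial, hH.symm y.2 trivial]
  pos y _ u hu := by
    rw [prodMetric_apply]
    have h1 : ∀ v, 0 ≤ G y.1 v v := fun v => by
      by_cases h : v = 0
      · simp [h]
      · exact (hG.pos y.1 trivial v h).le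
    have h2 : ∀ v, 0 ≤ H y.2 v v := fun v => by
      by_cases h : v = 0
      · simp [h]
      · exact (hH.pos y.2 trivial v h).le
    by_cases h : u.1 = 0
    · exact add_pos_of_nonneg_of_pos (h1 _) (hH.pos y.2 trivial _ fun h' => hu (Prod.ext h h'))
    · exact add_pos_of_pos_of_nonneg (hG.pos y.1 trivial _ h) (h2 _)

theorem fderiv_prodMetric (hG : IsMetricOn G Set.univ) (hH : IsMetricOn H Set.univ)
    (p a u v : E × F) :
    fderiv ℝ (prodMetric G H) p a u v =
      fderiv ℝ G p.1 a.1 u.1 v.1 + fderiv ℝ H p.2 a.2 u.2 v.2 := by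
  have hGH := isMetricOn_prodMetric hG hH
  have hG' := (hG.differentiableAt (Set.mem_univ p.1)).hasFDerivAt
  have hH' := (hH.differentiableAt (Set.mem_univ p.2)).hasFDerivAt
  have h1 := ((hG'.comp p hasFDerivAt_fst).clm_apply (hasFDerivAt_const u.1 p)).clm_apply
    (hasFDerivAt_const v.1 p)
  have h2 := ((hH'.comp p hasFDerivAt_snd).clm_apply (hasFDerivAt_const u.2 p)).clm_apply
    (hasFDerivAt_const v.2 p)
  rw [← fderiv_apply_apply (hGH.differentiableAt (Set.mem_univ p))]
  have h3 : (fun z => prodMetric G H z u v) =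
      fun z => (G ∘ Prod.fst) z u.1 v.1 + (H ∘ Prod.snd) z u.2 v.2 := rfl
  rw [h3, (h1.fun_add h2).fderiv]
  simp

theorem christoffel_prodMetric (hG : IsMetricOn G Set.univ) (hH : IsMetricOn H Set.univ)
    (p u v : E × F) :
    christoffel (prodMetric G H) p u v =
      (christoffel G p.1 u.1 v.1, christoffel H p.2 u.2 v.2) := by
  have hGH := isMetricOn_prodMetric hG hH
  refine hGH.christoffel_eq (Set.mem_univ p) fun w => ?_
  rw [christoffelFst_apply, prodMetric_apply, hG.apply_christoffel (Set.mem_univ _),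
    hH.apply_christoffel (Set.mem_univ _), fderiv_prodMetric hG hH, fderiv_prodMetric hG hH,
    fderiv_prodMetric hG hH, christoffelFst_apply, christoffelFst_apply]
  ring

theorem curvature_prodMetric (hG : IsMetricOn G Set.univ) (hH : IsMetricOn H Set.univ)
    (p v w : E × F) :
    curvature (prodMetric G H) p v w =
      (curvature G p.1 v.1 w.1).prodMap (curvature H p.2 v.2 w.2) := by
  have hGH := isMetricOn_prodMetric hG hH
  have hd : ∀ a u v, fderiv ℝ (christoffel (prodMetric G H)) p a u v =
      (fderiv ℝ (christoffel G) p.1 a.1 u.1 v.1, fderiv ℝ (christoffel H) p.2 a.2 u.2 v.2) := by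
    intro a u v
    have hG' := (hG.differentiableAt_christoffel (Set.mem_univ p.1)).hasFDerivAt
    have hH' := (hH.differentiableAt_christoffel (Set.mem_univ p.2)).hasFDerivAt
    have h1 := ((hG'.comp p hasFDerivAt_fst).clm_apply (hasFDerivAt_const u.1 p)).clm_apply
      (hasFDerivAt_const v.1 p)
    have h2 := ((hH'.comp p hasFDerivAt_snd).clm_apply (hasFDerivAt_const u.2 p)).clm_apply
      (hasFDerivAt_const v.2 p)
    rw [← fderiv_apply_apply (hGH.differentiableAt_christoffel (Set.mem_univ p))]
    have h3 : (fun z => christoffel (prodMetric G H) z u v) =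
        fun z => ((christoffel G ∘ Prod.fst) z u.1 v.1, (christoffel H ∘ Prod.snd) z u.2 v.2) :=
      funext fun z => christoffel_prodMetric hG hH z u v
    rw [h3, (h1.prodMk h2).fderiv]
    simp
  refine ContinuousLinearMap.ext fun u => ?_
  change _ = (curvature G p.1 v.1 w.1 u.1, curvature H p.2 v.2 w.2 u.2)
  rw [curvature_apply, curvature_apply, curvature_apply, hd, hd]
  simp only [christoffel_prodMetric hG hH]
  rfl

/-- The curvature endomorphism is block diagonal, so its trace is a sum. -/
theorem ricci_prodMetric (hG : IsMetricOn G Set.univ) (hH : IsMetricOn H Set.univ)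
    (p v w : E × F) :
    ricci (prodMetric G H) p v w = ricci G p.1 v.1 w.1 + ricci H p.2 v.2 w.2 := by
  rw [ricci, curvature_prodMetric hG hH, ricci, ricci, ← LinearMap.trace_prodMap']
  rfl

/-- `m` is the minimum of the quadratic form on the compact unit sphere; an empty sphere means the
zero space. -/
theorem exists_pos_mul_norm_sq_le {B : E →L[ℝ] E →L[ℝ] ℝ} (hB : ∀ u, u ≠ 0 → 0 < B u u) :
    ∃ m > 0, ∀ v, m * ‖v‖ ^ 2 ≤ B v v := by
  have : ProperSpace E := FiniteDimensional.proper ℝ E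
  by_cases hE : (Metric.sphere (0 : E) 1).Nonempty
  · obtain ⟨u, hu, hmin⟩ := (isCompact_sphere (0 : E) 1).exists_isMinOn hE
      (f := fun v => B v v) (by fun_prop)
    have hu' : ‖u‖ = 1 := by simpa using hu
    refine ⟨B u u, hB u (by rintro rfl; simp at hu'), fun v => ?_⟩
    by_cases hv : v = 0
    · simp [hv]
    have hv' : ‖v‖ ≠ 0 := norm_ne_zero_iff.2 hv
    have h1 : (‖v‖⁻¹ • v) ∈ Metric.sphere (0 : E) 1 := by
      simp [norm_smul, hv']
    have h2 : B u u ≤ ‖v‖⁻¹ * (‖v‖⁻¹ * B v v) := by simpa using hmin h1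
    calc B u u * ‖v‖ ^ 2 ≤ ‖v‖⁻¹ * (‖v‖⁻¹ * B v v) * ‖v‖ ^ 2 := by gcongr
      _ = B v v := by field_simp
  · refine ⟨1, one_pos, fun v => ?_⟩
    by_cases hv : v = 0
    · simp [hv]
    · exact (hE ⟨‖v‖⁻¹ • v, by simp [norm_smul, hv]⟩).elim

theorem isVonNBounded_of_pos {B : E →L[ℝ] E →L[ℝ] ℝ} (hB : ∀ u, u ≠ 0 → 0 < B u u) :
    Bornology.IsVonNBounded ℝ {v | B v v < 1} := by
  obtain ⟨m, hm, h⟩ := exists_pos_mul_norm_sq_le hB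
  -- This radius avoids a square root: `m * (m⁻¹ + 1) ^ 2 = m⁻¹ + 2 + m` exceeds 1.
  refine (NormedSpace.isVonNBounded_closedBall ℝ E (m⁻¹ + 1)).subset fun v hv => ?_
  have h1 : m * ‖v‖ ^ 2 < 1 := (h v).trans_lt hv
  have h2 : m * m⁻¹ = 1 := mul_inv_cancel₀ hm.ne'
  have h3 : 0 < m⁻¹ := inv_pos.2 hm
  rw [mem_closedBall_zero_iff]
  by_contra! h4
  have h5 : m * (m⁻¹ + 1) ^ 2 ≤ m * ‖v‖ ^ 2 := by gcongr
  nlinarith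

end Local

/-! ### Kähler metrics on vector spaces -/

section VectorSpace

variable {E : Type*} [NormedAddCommGroup E] [NormedSpace ℂ E]

/-- A bilinear form depending on a point of a vector space, as a form on the tangent bundle. -/
def tangentForm (G : E → E →L[ℝ] E →L[ℝ] ℝ) (x : E) :
    TangentSpace 𝓘(ℝ, E) x →L[ℝ] TangentSpace 𝓘(ℝ, E) x →L[ℝ] ℝ :=
  G x

/-- The preferred charts of a vector space are all the identity. -/
theorem inChart_model (b : ∀ x : E, TangentSpace 𝓘(ℝ, E) x →L[ℝ] TangentSpace 𝓘(ℝ, E) x →L[ℝ] ℝ)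
    (x : E) : inChart b x = modelForm b := by
  ext y u v
  have hid : ((extChartAt 𝓘(ℝ, E) x).symm : E → E) = id := rfl
  have : chartDeriv x y = ContinuousLinearMap.id ℝ E := by
    rw [chartDeriv, hid]
    exact mfderiv_id
  rw [inChart_apply, this, hid]
  rfl

theorem contMDiff_tangentForm {G : E → E →L[ℝ] E →L[ℝ] ℝ} (hG : ContDiff ℝ ∞ G) :
    ContMDiff 𝓘(ℝ, E) (𝓘(ℝ, E).prod 𝓘(ℝ, E →L[ℝ] E →L[ℝ] ℝ)) ∞
      (fun x => Bundle.TotalSpace.mk' (E →L[ℝ] E →L[ℝ] ℝ)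
        (E := fun x => TangentSpace 𝓘(ℝ, E) x →L[ℝ] TangentSpace 𝓘(ℝ, E) x →L[ℝ] ℝ)
        x (tangentForm G x)) := by
  intro x
  rw [Bundle.contMDiffAt_section]
  have h : ContMDiffAt 𝓘(ℝ, E) 𝓘(ℝ, E →L[ℝ] E →L[ℝ] ℝ) ∞ G x := hG.contMDiff.contMDiffAt
  convert! h
  rename_i y
  ext v w
  have hy : y ∈ (trivializationAt E (TangentSpace 𝓘(ℝ, E)) x).baseSet := Set.mem_univ y
  rw [hom_trivializationAt_apply,
    inCoordinates_apply_eq₂ (F₁ := E) (F₂ := E) (F₃ := ℝ) hy hy (Set.mem_univ _),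
    ← Bundle.Trivialization.symmL_apply (R := ℝ) _ hy,
    ← Bundle.Trivialization.symmL_apply (R := ℝ) _ hy, TangentBundle.symmL_model_space]
  simp
  rfl

theorem fderiv_inChart_tangentForm {G : E → E →L[ℝ] E →L[ℝ] ℝ} {x : E}
    (hG : DifferentiableAt ℝ G x) (u v w : E) :
    fderiv ℝ (fun y => inChart (tangentForm G) x y v w) (extChartAt 𝓘(ℝ, E) x x) u =
      fderiv ℝ G x u v w := by
  rw [inChart_model]
  exact fderiv_apply_apply hG v w u

/-- The Kähler metric on a vector space defined by a Hermitian metric with closed fundamental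
form. -/
def KaehlerMetric.ofModel [FiniteDimensional ℂ E] (G : E → E →L[ℝ] E →L[ℝ] ℝ)
    (hG : IsMetricOn G Set.univ)
    (hJ : ∀ y u v, G y (mulI E u) (mulI E v) = G y u v)
    (hclosed : ∀ y u v w, fderiv ℝ G y u (mulI E v) w + fderiv ℝ G y v (mulI E w) u +
      fderiv ℝ G y w (mulI E u) v = 0) : KaehlerMetric E E where
  inner := tangentForm G
  symm y := hG.symm y trivial
  pos y := hG.pos y trivial
  isVonNBounded y := isVonNBounded_of_pos (E := E) (B := G y) (hG.pos y trivial)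
  contMDiff := contMDiff_tangentForm (contDiffOn_univ.1 hG.smooth)
  hermitian := hJ
  closed x u v w := by
    have h := hG.differentiableAt (Set.mem_univ x)
    rw [fderiv_inChart_tangentForm h, fderiv_inChart_tangentForm h, fderiv_inChart_tangentForm h]
    exact hclosed x u v w

theorem isRMG_univ_iff (g : KaehlerMetric E E) (lam : ℝ) (α : ℝ → E) :
    IsRMG g lam Set.univ α ↔
      ContDiff ℝ ∞ α ∧ ∀ t w, modelForm g.inner (α t) (deriv (deriv α) t +
        christoffel (modelForm g.inner) (α t) (deriv α t) (deriv α t)) w =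
        lam * ricci (modelForm g.inner) (α t) (mulI E (deriv α t)) w := by
  have hacc : ∀ t, acceleration g Set.univ α t = deriv (deriv α) t +
      christoffel (modelForm g.inner) (α t) (deriv α t) (deriv α t) := fun t => by
    have hc : (fun s => extChartAt 𝓘(ℝ, E) (α t) (α s)) = α := rfl
    rw [acceleration, hc, inChart_model, derivWithin_univ, derivWithin_univ]
  have hvel : ∀ t, velocity Set.univ α t = deriv α t := fun t => by
    rw [velocity, mfderivWithin_univ, mfderiv_eq_fderiv]
    rfl
  have hric : ∀ t w, ricciForm g (α t) (velocity Set.univ α t) w =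
      ricci (modelForm g.inner) (α t) (mulI E (deriv α t)) w := fun t w => by
    rw [hvel]
    change ricci (inChart g.inner (α t)) (extChartAt 𝓘(ℝ, E) (α t) (α t)) (mulI E (deriv α t)) w = _
    rw [inChart_model]
    rfl
  constructor
  · exact fun h => ⟨(contMDiffOn_univ.1 h.smooth).contDiff, fun t w =>
      (congrArg (fun a => modelForm g.inner (α t) a w) (hacc t).symm).trans
        ((h.eq t trivial w).trans (congrArg (lam * ·) (hric t w)))⟩
  · exact fun h => ⟨h.1.contMDiff.contMDiffOn, fun t _ w =>
      (congrArg (fun a => modelForm g.inner (α t) a w) (hacc t)).trans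
        ((h.2 t w).trans (congrArg (lam * ·) (hric t w).symm))⟩

theorem isHolomorphicIsometric_clm {F : Type*} [NormedAddCommGroup F] [NormedSpace ℂ F]
    (g : KaehlerMetric E E) (h : KaehlerMetric F F) (f : E →L[ℂ] F)
    (hf : ∀ x u v, modelForm h.inner (f x) (f u) (f v) = modelForm g.inner x u v) :
    IsHolomorphicIsometric g h f := by
  have hd : ∀ x, mfderiv 𝓘(ℝ, E) 𝓘(ℝ, F) f x = f.restrictScalars ℝ := fun x =>
    (f.restrictScalars ℝ).mfderiv_eq
  refine ⟨(f.restrictScalars ℝ).contMDiff, fun x u => ?_, fun x u v => ?_⟩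
  · rw [hd]
    exact f.map_smul Complex.I u
  · rw [hd]
    exact hf x u v

end VectorSpace

/-! ### A conformal metric on the complex line -/

/-- The real inner product of the complex line. -/
def dot : ℂ →L[ℝ] ℂ →L[ℝ] ℝ :=
  Complex.reCLM.smulRight Complex.reCLM + Complex.imCLM.smulRight Complex.imCLM

theorem dot_apply (u v : ℂ) : dot u v = u.re * v.re + u.im * v.im := by
  simp [dot]

/-- The metric `exp |z|² |dz|²` on the complex line. -/
def expMetric (z : ℂ) : ℂ →L[ℝ] ℂ →L[ℝ] ℝ := Real.exp (dot z z) • dot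

theorem expMetric_apply (z u v : ℂ) : expMetric z u v = Real.exp (dot z z) * dot u v := rfl

theorem contDiff_expMetric : ContDiff ℝ ∞ expMetric := by
  have h : ContDiff ℝ ∞ fun z : ℂ => dot z z := dot.contDiff.clm_apply contDiff_id
  exact (Real.contDiff_exp.comp h).smul contDiff_const

theorem isMetricOn_expMetric : IsMetricOn expMetric Set.univ where
  isOpen := isOpen_univ
  smooth := contDiff_expMetric.contDiffOn
  symm z _ u v := by simp only [expMetric_apply, dot_apply]; ring
  pos z _ u hu := by
    rw [expMetric_apply, dot_apply, ← Complex.normSq_apply]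
    exact mul_pos (Real.exp_pos _) (Complex.normSq_pos.2 hu)

theorem fderiv_expMetric (z a u v : ℂ) :
    fderiv ℝ expMetric z a u v = 2 * dot z a * (Real.exp (dot z z) * dot u v) := by
  rw [← fderiv_apply_apply (isMetricOn_expMetric.differentiableAt (Set.mem_univ z))]
  have h : HasFDerivAt (fun z : ℂ => dot z z) _ z :=
    (dot.hasFDerivAt (x := z)).clm_apply (hasFDerivAt_id z)
  have h2 : HasFDerivAt (fun z => expMetric z u v) _ z := (h.exp).mul_const (dot u v)
  rw [h2.fderiv]
  simp [dot_apply]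
  ring

/-- The Christoffel symbols of `expMetric`. -/
def expChristoffel (z v w : ℂ) : ℂ := dot z v • w + dot z w • v - dot v w • z

theorem christoffel_expMetric (z v w : ℂ) :
    christoffel expMetric z v w = expChristoffel z v w := by
  refine isMetricOn_expMetric.christoffel_eq (Set.mem_univ z) fun x => ?_
  simp only [christoffelFst_apply, fderiv_expMetric, expMetric_apply, expChristoffel, dot_apply,
    Complex.add_re, Complex.add_im, Complex.sub_re, Complex.sub_im, Complex.real_smul,
    Complex.mul_re, Complex.mul_im, Complex.ofReal_re, Complex.ofReal_im]
  ring

/-- `expChristoffel` is linear in the base point, so differentiating replaces `z` by the direction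
`a`. -/
theorem fderiv_christoffel_expMetric (z a v w : ℂ) :
    fderiv ℝ (christoffel expMetric) z a v w = expChristoffel a v w := by
  rw [← fderiv_apply_apply (isMetricOn_expMetric.differentiableAt_christoffel (Set.mem_univ z))]
  simp only [christoffel_expMetric]
  let L : ℂ →L[ℝ] ℂ := (dot.flip v).smulRight w + (dot.flip w).smulRight v -
    dot v w • ContinuousLinearMap.id ℝ ℂ
  have hL : (fun z => expChristoffel z v w) = L := rfl
  rw [hL, L.fderiv]
  rfl

theorem trace_complex (L : ℂ →L[ℝ] ℂ) :
    LinearMap.trace ℝ ℂ L = (L 1).re + (L Complex.I).im := by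
  rw [LinearMap.trace_eq_matrix_trace ℝ Complex.basisOneI, Matrix.trace_fin_two]
  simp [LinearMap.toMatrix_apply]

/-- For a conformal metric exp(2f)|dz|² on the plane, Ric = -(Δf)|dz|²; here f = |z|²/2 and Δf = 2.
The force is therefore nonzero along every moving curve when λ ≠ 0. -/
theorem ricci_expMetric (z v w : ℂ) : ricci expMetric z v w = -2 * dot v w := by
  rw [ricci, trace_complex, curvature_apply, curvature_apply]
  simp only [fderiv_christoffel_expMetric, christoffel_expMetric, expChristoffel, dot_apply,
    Complex.add_re, Complex.add_im, Complex.sub_re, Complex.sub_im, Complex.real_smul,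
    Complex.mul_re, Complex.mul_im, Complex.ofReal_re, Complex.ofReal_im, Complex.one_re,
    Complex.one_im, Complex.I_re, Complex.I_im]
  ring

theorem dot_mulI_mulI (u v : ℂ) : dot (mulI ℂ u) (mulI ℂ v) = dot u v := by
  simp [mulI, dot_apply]
  ring

/-- The metric `2 exp |z|² |dz|²` on the complex line. -/
def twiceExpKaehler : KaehlerMetric ℂ ℂ :=
  KaehlerMetric.ofModel (fun z => (2 : ℝ) • expMetric z)
    (isMetricOn_expMetric.const_smul two_pos)
    (fun z u v => by simp only [smul_apply, expMetric_apply, dot_mulI_mulI])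
    (fun z u v w => by
      rw [fderiv_fun_const_smul (isMetricOn_expMetric.differentiableAt (Set.mem_univ z))]
      simp [fderiv_expMetric, mulI, dot_apply]
      ring)

theorem modelForm_twiceExpKaehler :
    modelForm twiceExpKaehler.inner = fun z => (2 : ℝ) • expMetric z := rfl

/-- The product metric `exp |z|² |dz|² + exp |w|² |dw|²` on the complex plane. -/
def prodExpKaehler : KaehlerMetric (ℂ × ℂ) (ℂ × ℂ) :=
  KaehlerMetric.ofModel (prodMetric expMetric expMetric)
    (isMetricOn_prodMetric isMetricOn_expMetric isMetricOn_expMetric)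
    (fun z u v => by
      have h := dot_mulI_mulI
      simp only [mulI] at h
      simp [mulI, prodMetric_apply, expMetric_apply] at h ⊢
      simp [h])
    (fun z u v w => by
      rw [fderiv_prodMetric isMetricOn_expMetric isMetricOn_expMetric,
        fderiv_prodMetric isMetricOn_expMetric isMetricOn_expMetric,
        fderiv_prodMetric isMetricOn_expMetric isMetricOn_expMetric]
      simp [fderiv_expMetric, mulI, dot_apply]
      ring)

theorem modelForm_prodExpKaehler :
    modelForm prodExpKaehler.inner = prodMetric expMetric expMetric := rfl

/-! ### The diagonal of the product -/

/-- The exchange of the factors. -/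
def swapPerm : Equiv.Perm (ℂ × ℂ) := Equiv.prodComm ℂ ℂ

theorem swapPerm_mul_self : swapPerm * swapPerm = 1 := by
  ext <;> rfl

theorem eq_one_or_eq_swapPerm {φ : Equiv.Perm (ℂ × ℂ)} (hφ : φ ∈ Subgroup.zpowers swapPerm) :
    φ = 1 ∨ φ = swapPerm := by
  obtain ⟨n, rfl⟩ := Subgroup.mem_zpowers_iff.1 hφ
  have h2 : ∀ m : ℤ, swapPerm ^ (2 * m) = 1 := fun m => by
    rw [zpow_mul, zpow_ofNat, pow_two, swapPerm_mul_self, one_zpow]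
  rcases Int.even_or_odd' n with ⟨m, rfl | rfl⟩
  · exact Or.inl (h2 m)
  · exact Or.inr (by rw [zpow_add, h2, zpow_one, one_mul])

theorem isGroupOfHolomorphicIsometries_swapPerm :
    IsGroupOfHolomorphicIsometries prodExpKaehler (Subgroup.zpowers swapPerm) := by
  intro φ hφ
  rcases eq_one_or_eq_swapPerm hφ with rfl | rfl
  · exact isHolomorphicIsometric_id _
  · refine isHolomorphicIsometric_clm prodExpKaehler prodExpKaehler
      ((ContinuousLinearMap.snd ℂ ℂ ℂ).prod (ContinuousLinearMap.fst ℂ ℂ ℂ)) fun p u v => ?_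
    simp only [modelForm_prodExpKaehler, prodMetric_apply]
    exact add_comm _ _

/-- The diagonal embedding of the complex line. -/
def diag : ℂ →L[ℂ] ℂ × ℂ := (ContinuousLinearMap.id ℂ ℂ).prod (ContinuousLinearMap.id ℂ ℂ)

theorem diag_apply (z : ℂ) : diag z = (z, z) := rfl

theorem isHolomorphicIsometric_diag :
    IsHolomorphicIsometric twiceExpKaehler prodExpKaehler diag := by
  refine isHolomorphicIsometric_clm twiceExpKaehler prodExpKaehler diag fun z u v => ?_
  simp only [modelForm_prodExpKaehler, prodMetric_apply, modelForm_twiceExpKaehler, diag_apply,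
    smul_apply, smul_eq_mul, two_mul]

theorem isEmbedding_diag : Topology.IsEmbedding diag :=
  Topology.IsEmbedding.of_leftInverse (f := Prod.fst) (fun _ => rfl) continuous_fst diag.continuous

/-- The whole fixed set is the diagonal, a connected image of ℂ. -/
theorem isFixedComponent_diag :
    IsFixedComponent (Subgroup.zpowers swapPerm) (Set.range diag) := by
  have hfix : MulAction.fixedPoints (Subgroup.zpowers swapPerm) (ℂ × ℂ) = Set.range diag := by
    ext p
    constructor
    · intro hp
      have h : (p.2, p.1) = p := hp ⟨swapPerm, Subgroup.mem_zpowers swapPerm⟩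
      exact ⟨p.1, Prod.ext rfl (congrArg Prod.snd h : p.1 = p.2)⟩
    · rintro ⟨z, rfl⟩ ⟨φ, hφ⟩
      change φ (diag z) = diag z
      rcases eq_one_or_eq_swapPerm hφ with rfl | rfl <;> rfl
  refine ⟨diag 0, hfix ▸ Set.mem_range_self 0, ?_⟩
  rw [hfix]
  exact ((isPreconnected_range diag.continuous).connectedComponentIn (Set.mem_range_self 0)).symm

/-! ### Circular Ricci magnetic geodesics -/

/-- The uniform motion with angular velocity `a` on the unit circle. -/
def circleCurve (a : ℝ) (t : ℝ) : ℂ := Complex.exp (t * (a * Complex.I))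

theorem hasDerivAt_circleCurve (a t : ℝ) :
    HasDerivAt (circleCurve a) (circleCurve a t * (a * Complex.I)) t := by
  have h := (((hasDerivAt_id (t : ℂ)).mul_const (a * Complex.I)).cexp).comp_ofReal
  simpa [circleCurve] using! h

theorem deriv_circleCurve (a : ℝ) :
    deriv (circleCurve a) = fun t => circleCurve a t * (a * Complex.I) :=
  funext fun t => (hasDerivAt_circleCurve a t).deriv

theorem deriv_deriv_circleCurve (a t : ℝ) :
    deriv (deriv (circleCurve a)) t = circleCurve a t * (a * Complex.I) * (a * Complex.I) := by
  rw [deriv_circleCurve]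
  exact ((hasDerivAt_circleCurve a t).mul_const _).deriv

theorem contDiff_circleCurve (a : ℝ) : ContDiff ℝ ∞ (circleCurve a) :=
  (Complex.ofRealCLM.contDiff.mul contDiff_const).cexp

theorem dot_circleCurve_self (a t : ℝ) : dot (circleCurve a t) (circleCurve a t) = 1 := by
  rw [dot_apply, ← Complex.normSq_apply, Complex.normSq_eq_norm_sq, circleCurve,
    show (t : ℂ) * (a * Complex.I) = ((t * a : ℝ) : ℂ) * Complex.I by push_cast; ring,
    Complex.norm_exp_ofReal_mul_I, one_pow]

/-- The acceleration of the circular motion in the metric `expMetric`. -/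
theorem circleCurve_acceleration (a t : ℝ) :
    deriv (deriv (circleCurve a)) t +
      christoffel expMetric (circleCurve a t) (deriv (circleCurve a) t) (deriv (circleCurve a) t) =
    (-2 * a ^ 2 : ℝ) • circleCurve a t := by
  have h := dot_circleCurve_self a t
  rw [dot_apply] at h
  rw [deriv_deriv_circleCurve, deriv_circleCurve, christoffel_expMetric]
  beta_reduce
  generalize circleCurve a t = z at h ⊢
  apply Complex.ext
  · simp only [expChristoffel, dot_apply, Complex.add_re, Complex.sub_re, Complex.real_smul,
      Complex.mul_re, Complex.mul_im, Complex.ofReal_re, Complex.ofReal_im, Complex.I_re,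
      Complex.I_im]
    linear_combination (-a ^ 2 * z.re) * h
  · simp only [expChristoffel, dot_apply, Complex.add_im, Complex.sub_im, Complex.real_smul,
      Complex.mul_re, Complex.mul_im, Complex.ofReal_re, Complex.ofReal_im, Complex.I_re,
      Complex.I_im]
    linear_combination (-a ^ 2 * z.im) * h

/-- The Ricci force on the circular motion in the metric `expMetric`. -/
theorem circleCurve_ricci (a t : ℝ) (w : ℂ) :
    ricci expMetric (circleCurve a t) (mulI ℂ (deriv (circleCurve a) t)) w =
      2 * a * dot (circleCurve a t) w := by
  rw [ricci_expMetric, deriv_circleCurve]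
  simp [mulI, dot_apply]
  ring

/-- On the unit circle the conformal factor is e, so the sides are -2a²e⟨z, w⟩ and 2aλ⟨z, w⟩, which
agree when λ = -ea. -/
theorem circleCurve_eq {a lam : ℝ} (ha : -Real.exp 1 * a = lam) (t : ℝ) (w : ℂ) :
    expMetric (circleCurve a t) (deriv (deriv (circleCurve a)) t +
      christoffel expMetric (circleCurve a t) (deriv (circleCurve a) t)
        (deriv (circleCurve a) t)) w =
    lam * ricci expMetric (circleCurve a t) (mulI ℂ (deriv (circleCurve a) t)) w := by
  rw [circleCurve_acceleration, circleCurve_ricci, expMetric_apply, dot_circleCurve_self, map_smul,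
    smul_apply, smul_eq_mul, ← ha]
  ring

/-- Every term of the equation splits over the two factors, and each factor is `circleCurve_eq`. -/
theorem isRMG_diag_circleCurve {a lam : ℝ} (ha : -Real.exp 1 * a = lam) :
    IsRMG prodExpKaehler lam Set.univ (diag ∘ circleCurve a) := by
  have hd : ∀ {c : ℝ → ℂ} {c' : ℂ} {t : ℝ}, HasDerivAt c c' t →
      HasDerivAt (fun t => (c t, c t)) (c', c') t := fun h => h.prodMk h
  have h1 : deriv (diag ∘ circleCurve a) =
      fun t => (deriv (circleCurve a) t, deriv (circleCurve a) t) :=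
    funext fun t => (hd (hasDerivAt_circleCurve a t).differentiableAt.hasDerivAt).deriv
  have h2 : ∀ t, deriv (deriv (diag ∘ circleCurve a)) t =
      (deriv (deriv (circleCurve a)) t, deriv (deriv (circleCurve a)) t) := fun t => by
    rw [h1]
    refine (hd (DifferentiableAt.hasDerivAt ?_)).deriv
    rw [deriv_circleCurve]
    exact ((hasDerivAt_circleCurve a t).mul_const _).differentiableAt
  refine (isRMG_univ_iff _ _ _).2
    ⟨(contDiff_circleCurve a).prodMk (contDiff_circleCurve a), fun t w => ?_⟩
  rw [modelForm_prodExpKaehler, prodMetric_apply,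
    ricci_prodMetric isMetricOn_expMetric isMetricOn_expMetric,
    christoffel_prodMetric isMetricOn_expMetric isMetricOn_expMetric, h2, h1, mul_add]
  exact congrArg₂ (· + ·) (circleCurve_eq ha t w.1) (circleCurve_eq ha t w.2)

theorem not_isRMG_circleCurve {a lam : ℝ} (ha : -Real.exp 1 * a = lam) (hlam : lam ≠ 0) :
    ¬ IsRMG twiceExpKaehler lam Set.univ (circleCurve a) := by
  intro h
  -- Tested against the position vector, the force for `expMetric` is `lam * (2 * a)`. Doubling the
  -- metric doubles only the acceleration side, so `2 * (lam * (2 * a)) = lam * (2 * a)`, hence `lam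
  -- * a = 0`.
  have h1 := ((isRMG_univ_iff _ _ _).1 h).2 0 (circleCurve a 0)
  have hΓ : christoffel (modelForm twiceExpKaehler.inner) = christoffel expMetric :=
    christoffel_const_smul isMetricOn_expMetric two_pos
  rw [ricci_congr hΓ, hΓ, modelForm_twiceExpKaehler, smul_apply, smul_apply, circleCurve_eq ha,
    circleCurve_ricci, dot_circleCurve_self, smul_eq_mul, mul_one] at h1
  have ha' : a ≠ 0 := by
    rintro rfl
    simp at ha
    exact hlam ha.symm
  have h2 : lam * a = 0 := by linarith
  exact mul_ne_zero hlam ha' h2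

end Kaehler
end

open Kaehler in
theorem corollary2p2 :
    -- RMG curves with initial velocity tangent to the component `S` remain in `S`
    (∀ (E : Type*) [NormedAddCommGroup E] [NormedSpace ℂ E] [FiniteDimensional ℂ E]
      (M : Type*) [TopologicalSpace M] [T2Space M] [ChartedSpace E M] [IsManifold 𝓘(ℂ, E) ω M]
      (g : KaehlerMetric E M) (G : Subgroup (Equiv.Perm M)) (S : Set M) (lam : ℝ)
      (I : Set ℝ) (α : ℝ → M),
      IsGroupOfHolomorphicIsometries g G →
      IsFixedComponent G S →
      I.OrdConnected → (0 : ℝ) ∈ I →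
      IsRMG g lam I α →
      IsTangentTo S (⟨α 0, velocity I α 0⟩ : TangentBundle 𝓘(ℝ, E) M) →
      ∀ t ∈ I, α t ∈ S) ∧
    -- the flow so obtained on the component need not be its intrinsic RMG flow
    (∃ (g : KaehlerMetric (ℂ × ℂ) (ℂ × ℂ)) (G : Subgroup (Equiv.Perm (ℂ × ℂ)))
      (h : KaehlerMetric ℂ ℂ) (f : ℂ → ℂ × ℂ),
      IsGroupOfHolomorphicIsometries g G ∧
      IsFixedComponent G (Set.range f) ∧
      Topology.IsEmbedding f ∧
      IsHolomorphicIsometric h g f ∧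
      ∀ lam : ℝ, lam ≠ 0 → ∃ α : ℝ → ℂ,
        ContMDiff 𝓘(ℝ, ℝ) 𝓘(ℝ, ℂ) ∞ α ∧
        IsRMG g lam Set.univ (f ∘ α) ∧ ¬ IsRMG h lam Set.univ α) := by
  refine ⟨?_, prodExpKaehler, Subgroup.zpowers swapPerm, twiceExpKaehler, diag,
    isGroupOfHolomorphicIsometries_swapPerm, isFixedComponent_diag, isEmbedding_diag,
    isHolomorphicIsometric_diag, fun lam hlam => ?_⟩
  · intro E _ _ _ M _ _ _ _ g G S lam I α hG hS hI h0 hα hT t ht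
    exact hα.mem_of_isTangentTo hG hS hI h0 hT ht
  -- The angular velocity is the solution of `-Real.exp 1 * a = lam`, the balance found in
  -- `circleCurve_eq`.
  · have ha : -Real.exp 1 * (-lam / Real.exp 1) = lam := by
      field_simp
    exact ⟨circleCurve (-lam / Real.exp 1), (contDiff_circleCurve _).contMDiff,
      isRMG_diag_circleCurve ha, not_isRMG_circleCurve ha hlam⟩
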